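/- Let $N,M\ge 0$ be integers with $N>0$ or $M\ge 3$, and let $$T=\bigcup_{l=1}^{N+M}[a_l,b_l],\qquad a_l\le b_l,\quad b_{l-1}<a_l,$$ where $a_l<b_l$ for exactly $N$ of the indices $l$ (so $T$ consists of $N$ segments and $M$ isolated points). For $x\in T$ let $\sigma(x)=\inf\{s\in T: s>x\}$ if $x\neq\max T$, and $\sigma(\max T)=\max T$. For a compact set $X\subset\mathbb R$ let $X^0=X\setminus\{\max X\}$ if $\max X$ is left-isolated in $X$ (some point of $X$ lies to the left of $\max X$, and $\max X$ is not a limit of such points), and $X^0=X$ otherwise; put $X^{0^2}=(X^0)^0$. The $\Delta$-derivative on $T$ of a function $f$ at $t\in T^0$ is the number $f^\Delta(t)$ such that for every $\varepsilon>0$ there is $\delta>0$ with $|f(\sigma(t))-f(s)-f^\Delta(t)(\sigma(t)-s)|\le\varepsilon|\sigma(t)-s|$ for all $s\in T\cap(t-\delta,t+\delta)$; $f^{\Delta\Delta}$ on $T^{0^2}$ is the $\Delta$-derivative of $f^\Delta$ on the time scale $T^0$ (defined with the jump function of $T^0$). Let $q$ be a real-valued function continuous on $T^{0^2}$, and consider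 $$-y^{\Delta\Delta}(x)+q(x)\,y(\sigma(x))=\lambda\, y(\sigma(x)),\qquad x\in T^{0^2},\ \sigma(x)\in T^0. \tag{1}$$ A solution is a complex-valued function $y$ on $T$ for which $y^\Delta$ exists on $T^0$, $y^{\Delta\Delta}$ exists on $T^{0^2}$ and is rd-continuous there (continuous at points that are right-dense in $T$, with finite left limits at points that are left-dense in $T$), and (1) holds. (The restriction $\sigma(x)\in T^0$ excludes at most one point of $T^{0^2}$: the right end of a segment whose successor is the isolated point $\max T$. Equivalently, $y$ satisfies $-y''+qy=\lambda y$ inside the segments and, for consecutive components, $y(a_{l+1})=y(b_l)+(a_{l+1}-b_l)y^\Delta(b_l)$ for $1\le l\le N+M-1$ and $y^\Delta(a_{l+1})=y^\Delta(b_l)+(a_{l+1}-b_l)(q(b_l)-\lambda)\,y(a_{l+1})$ for $1\le l\le N+M-1$, the last relation with $l=N+M-1$ being omitted if $a_{N+M}=b_{N+M}$; here $y$ and $y^\Delta$ are continuous on $T$ and $T^0$.) For $j=0,1$ a number $\lambda\in\mathbb C$ is an eigenvalue of the problem $L_j(T)$ if (1) has a solution $y\not\equiv0$ on $T$ with $$L_1(T):\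 y^\Delta(\min T)=0,\ y(\max T)=0;\qquad L_0(T):\ y(\min T)=0,\ y(\max T)=0.$$ **Theorem 1.** All eigenvalues of $L_0(T)$ and $L_1(T)$ are real. If $N>0$, the sets of eigenvalues of $L_0(T)$ and of $L_1(T)$ are infinite and each can be numbered as a strictly increasing sequence $\lambda_{1j}<\lambda_{2j}<\dots$ ($j=0,1$), and $$\lambda_{n1}<\lambda_{n0}<\lambda_{n+1,1},\qquad n\ge 1.$$ If $N=0$, each of the two problems has exactly $M-2$ distinct eigenvalues $\lambda_{1j}<\dots<\lambda_{M-2,j}$, and $\lambda_{n1}<\lambda_{n0}<\lambda_{n+1,1}$ for $n=1,\dots,M-2$, where $\lambda_{M-1,1}:=+\infty$. -/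

import Mathlib

namespace TimeScale

noncomputable section

/-- The forward jump function: `inf {s ∈ T : s > x}`, and `x` itself if `x` is the maximum. -/
def fwd (T : Set ℝ) (x : ℝ) : ℝ :=
  open Classical in if ∃ s ∈ T, x < s then sInf {s | s ∈ T ∧ x < s} else x

/-- The backward jump function: `sup {s ∈ T : s < x}`, and `x` itself if `x` is the minimum. -/
def bwd (T : Set ℝ) (x : ℝ) : ℝ :=
  open Classical in if ∃ s ∈ T, s < x then sSup {s | s ∈ T ∧ s < x} else x

/-- `T⁰`: the set `T` without its maximum, if that exists and is left-isolated; otherwise `T`. -/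
def trunc (T : Set ℝ) : Set ℝ :=
  {x | x ∈ T ∧ ¬ (IsGreatest T x ∧ bwd T x < x)}

/-- The number `d` is a `Δ`-derivative at `t` of the function `f` on the time scale `T`. -/
def HasDeltaDerivAt (T : Set ℝ) (f : ℝ → ℂ) (d : ℂ) (t : ℝ) : Prop :=
  ∀ ε : ℝ, 0 < ε → ∃ δ : ℝ, 0 < δ ∧ ∀ s ∈ T, |s - t| < δ →
    ‖f (fwd T t) - f s - d * ((fwd T t - s : ℝ) : ℂ)‖ ≤ ε * |fwd T t - s|

/-- Rd-continuity of `f` on `D ⊆ T`: continuity at the points of `D` that are right-dense in `T`,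
and existence of finite left limits at the points of `D` that are left-dense in `T`. -/
def RdContinuousOn (T : Set ℝ) (f : ℝ → ℂ) (D : Set ℝ) : Prop :=
  (∀ t ∈ D, fwd T t = t → ContinuousWithinAt f D t) ∧
  (∀ t ∈ D, bwd T t = t → ∃ c : ℂ, Filter.Tendsto f (nhdsWithin t (D ∩ Set.Iio t)) (nhds c))

/-- `y` solves `-y^ΔΔ(x) + q(x) y(σ(x)) = lam * y(σ(x))` on the time scale `T`. The functions `y₁`
and `y₂` are `y^Δ` on `T⁰` and `y^ΔΔ` on `T⁰⁰`. The equation is required at those `x ∈ T⁰⁰` for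
which `y^Δ(σ(x))` is defined, that is `σ(x) ∈ T⁰`; the only point of `T⁰⁰` that this can leave out
is a left-dense point `x` for which `σ(x) > x` is the (isolated) maximum of `T`. -/
def IsSolution (T : Set ℝ) (q : ℝ → ℝ) (lam : ℂ) (y : ℝ → ℂ) : Prop :=
  ∃ y₁ y₂ : ℝ → ℂ,
    (∀ t ∈ trunc T, HasDeltaDerivAt T y (y₁ t) t) ∧
    (∀ t ∈ trunc (trunc T), HasDeltaDerivAt (trunc T) y₁ (y₂ t) t) ∧
    RdContinuousOn T y₂ (trunc (trunc T)) ∧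
    ∀ x ∈ trunc (trunc T), fwd T x ∈ trunc T →
      -(y₂ x) + (q x : ℂ) * y (fwd T x) = lam * y (fwd T x)

/-- The eigenvalues of `L₀(T)`, with boundary conditions `y(min T) = 0` and `y(max T) = 0`. -/
def spectrumL0 (T : Set ℝ) (q : ℝ → ℝ) : Set ℂ :=
  {lam | ∃ y : ℝ → ℂ, IsSolution T q lam y ∧ (∃ x ∈ T, y x ≠ 0) ∧
    y (sInf T) = 0 ∧ y (sSup T) = 0}

/-- The eigenvalues of `L₁(T)`, with boundary conditions `y^Δ(min T) = 0` and `y(max T) = 0`. -/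
def spectrumL1 (T : Set ℝ) (q : ℝ → ℝ) : Set ℂ :=
  {lam | ∃ y : ℝ → ℂ, IsSolution T q lam y ∧ (∃ x ∈ T, y x ≠ 0) ∧
    HasDeltaDerivAt T y 0 (sInf T) ∧ y (sSup T) = 0}

end

end TimeScale

namespace TimeScale

open Set Filter Topology

/-! Write y = r sin θ and y^Δ = r cos θ. Inside a segment the Prüfer angle satisfies θ' = cos²θ + (λ
- q) sin²θ. A gap of length h acts by two shears, y ↦ y + h z and then z ↦ z + h (q - λ) y, and each
shear is the time-h flow of a system y' = p z, z' = (Q - λ w) y with constant coefficients. So the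
angle is carried from min T to max T by a composition of flows of a single kind (`Piece`), with no
choice of branch at the jumps.

A comparison principle (`Piece.compare`) makes the end angle Θ(λ, x) strictly increasing in the
initial angle x and, for 0 ≤ x ≤ π/2, strictly increasing in λ. It is continuous in λ, and Θ(λ, x +
π) = Θ(λ, x) + π. Eigenvalues are real by the Lagrange identity (`IsSol.im_eq_zero`), so those of L₀
and L₁ are the real zeros of sin Θ(λ, 0) and sin Θ(λ, π/2). The interlacing is the inequality Θ(λ,
0) < Θ(λ, π/2) < Θ(λ, 0) + π.

It remains to see which multiples of π are attained. Both end angles are positive, and they are at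
most π/2 once λ is below the values of q. A segment makes them unbounded
(`exists_nat_mul_pi_le_endAngle`). For M isolated points exactly π, …, (M - 2)π are attained
(`endAngle_lt_of_discrete`, `exists_le_endAngle_of_discrete`). -/

/-! ### Scalar differential inequalities -/

theorem hasDerivAt_sq_min_zero (x : ℝ) :
    HasDerivAt (fun x : ℝ => (min x 0) ^ 2) (2 * min x 0) x := by
  rcases lt_trichotomy x 0 with hx | rfl | hx
  · have h : (fun x : ℝ => (min x 0) ^ 2) =ᶠ[𝓝 x] fun x => x ^ 2 := by
      filter_upwards [gt_mem_nhds hx] with y hy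
      rw [min_eq_left (le_of_lt hy)]
    rw [min_eq_left hx.le]
    simpa using (hasDerivAt_pow 2 x).congr_of_eventuallyEq h
  · rw [hasDerivAt_iff_isLittleO]
    have : (fun x : ℝ => x ^ 2) =o[𝓝 0] fun x => x := by
      simpa using Asymptotics.isLittleO_pow_pow (𝕜 := ℝ) (show 1 < 2 by norm_num)
    refine Asymptotics.IsBigO.trans_isLittleO (Asymptotics.IsBigO.of_bound 1 ?_)
      (by simpa using this)
    refine Eventually.of_forall fun y => ?_
    rcases le_total y 0 with h | h
    · simp [min_eq_left h]
    · simp [min_eq_right h]; positivity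
  · have h : (fun x : ℝ => (min x 0) ^ 2) =ᶠ[𝓝 x] fun _ => 0 := by
      filter_upwards [lt_mem_nhds hx] with y hy
      rw [min_eq_right (le_of_lt hy)]; norm_num
    rw [min_eq_right hx.le]
    simpa using (hasDerivAt_const x (0 : ℝ)).congr_of_eventuallyEq h

theorem monotoneOn_Icc_of_hasDerivAt {f f' : ℝ → ℝ} {a b : ℝ} (hf : ContinuousOn f (Icc a b))
    (hf' : ∀ t ∈ Ioo a b, HasDerivAt f (f' t) t) (h : ∀ t ∈ Ioo a b, 0 ≤ f' t) :
    MonotoneOn f (Icc a b) := by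
  refine monotoneOn_of_deriv_nonneg (convex_Icc a b) hf ?_ ?_
  · rw [interior_Icc]
    exact fun t ht => (hf' t ht).differentiableAt.differentiableWithinAt
  · rw [interior_Icc]
    exact fun t ht => by rw [(hf' t ht).deriv]; exact h t ht

/-- Where d < 0 the hypothesis gives (d²)' ≤ 2L d². Hence e^{-2Lt} min(d, 0)² is nonincreasing, and
it starts at 0. -/
theorem nonneg_of_neg_mul_abs_le_deriv {d d' : ℝ → ℝ} {a b L : ℝ} (hd : ContinuousOn d (Icc a b))
    (hd' : ∀ t ∈ Ioo a b, HasDerivAt d (d' t) t) (hL : ∀ t ∈ Ioo a b, -(L * |d t|) ≤ d' t)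
    (ha : 0 ≤ d a) {t : ℝ} (ht : t ∈ Icc a b) : 0 ≤ d t := by
  have hmono : MonotoneOn (fun t => -(Real.exp (-(2 * L * t)) * (min (d t) 0) ^ 2)) (Icc a b) := by
    refine monotoneOn_Icc_of_hasDerivAt (f' := fun t =>
      -(Real.exp (-(2 * L * t)) * (-(2 * L)) * (min (d t) 0) ^ 2 +
        Real.exp (-(2 * L * t)) * (2 * min (d t) 0 * d' t))) ?_ ?_ ?_
    · fun_prop
    · intro t ht
      have h1 : HasDerivAt (fun t => Real.exp (-(2 * L * t)))
          (Real.exp (-(2 * L * t)) * (-(2 * L))) t := by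
        simpa using (((hasDerivAt_id t).const_mul (2 * L)).neg).exp
      exact (h1.mul ((hasDerivAt_sq_min_zero (d t)).comp t (hd' t ht))).neg
    · intro t ht
      have h := hL t ht
      have he := Real.exp_pos (-(2 * L * t))
      have : 0 ≤ L * (min (d t) 0) ^ 2 - min (d t) 0 * d' t := by
        rcases le_total (d t) 0 with h0 | h0
        · rw [min_eq_left h0]
          rw [abs_of_nonpos h0] at h
          nlinarith
        · simp [min_eq_right h0]
      nlinarith
  have h := hmono (left_mem_Icc.2 (ht.1.trans ht.2)) ht ht.1
  simp only [min_eq_right ha] at h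
  by_contra hneg
  rw [min_eq_left (not_le.1 hneg).le] at h
  have : 0 < d t ^ 2 := by nlinarith
  have := mul_pos (Real.exp_pos (-(2 * L * t))) this
  nlinarith

/-- If `d' ≥ -L|d|` and `d` starts nonnegative, then `d` can only vanish at the right end of the
interval by vanishing identically. -/
theorem eq_zero_of_neg_mul_abs_le_deriv {d d' : ℝ → ℝ} {a b L : ℝ}
    (hd : ContinuousOn d (Icc a b))
    (hd' : ∀ t ∈ Ioo a b, HasDerivAt d (d' t) t) (hL : ∀ t ∈ Ioo a b, -(L * |d t|) ≤ d' t)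
    (ha : 0 ≤ d a) (hb : d b = 0) {t : ℝ} (ht : t ∈ Icc a b) : d t = 0 := by
  have hnn := fun t ht => nonneg_of_neg_mul_abs_le_deriv hd hd' hL ha (t := t) ht
  -- Since d ≥ 0, the bound reads d' ≥ -L d, so e^{Lt} d increases from a nonnegative value to 0.
  have hmono : MonotoneOn (fun t => Real.exp (L * t) * d t) (Icc a b) := by
    refine monotoneOn_Icc_of_hasDerivAt (f' := fun t =>
      Real.exp (L * t) * L * d t + Real.exp (L * t) * d' t) ?_ ?_ ?_
    · fun_prop
    · intro t ht
      have h1 : HasDerivAt (fun t => Real.exp (L * t)) (Real.exp (L * t) * L) t := by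
        simpa using ((hasDerivAt_id t).const_mul L).exp
      exact h1.mul (hd' t ht)
    · intro t ht
      have h := hL t ht
      rw [abs_of_nonneg (hnn t (Ioo_subset_Icc_self ht))] at h
      have he := Real.exp_pos (L * t)
      nlinarith
  have h := hmono ht (right_mem_Icc.2 (ht.1.trans ht.2)) ht.2
  simp only [hb, mul_zero] at h
  refine le_antisymm ?_ (hnn t ht)
  by_contra hc
  exact absurd h (not_le.2 (mul_pos (Real.exp_pos (L * t)) (not_le.1 hc)))

/-! ### The Prüfer angle of one linear system -/

theorem abs_cos_sq_sub_le (x y : ℝ) : |Real.cos x ^ 2 - Real.cos y ^ 2| ≤ |x - y| := by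
  have h : Real.cos x ^ 2 - Real.cos y ^ 2 = -(Real.sin (x + y) * Real.sin (x - y)) := by
    rw [Real.sin_add, Real.sin_sub]
    nlinarith [Real.sin_sq_add_cos_sq x, Real.sin_sq_add_cos_sq y]
  rw [h, abs_neg, abs_mul]
  calc _ ≤ 1 * |Real.sin (x - y)| := by gcongr; exact Real.abs_sin_le_one _
    _ ≤ |x - y| := by
      rw [one_mul]; exact Real.abs_sin_le_abs

/-- A linear system `y' = p z`, `z' = (Q - λ w) y` on a compact interval. -/
structure Piece where
  p : ℝ
  w : ℝ
  Q : ℝ → ℝ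
  a : ℝ
  b : ℝ
  p_nonneg : 0 ≤ p
  w_nonneg : 0 ≤ w
  le : a ≤ b
  cont : ContinuousOn Q (Icc a b)

namespace Piece

variable (P : Piece)

/-- The right-hand side of the equation for the Prüfer angle. -/
noncomputable def field (lam t θ : ℝ) : ℝ :=
  P.p * Real.cos θ ^ 2 + (lam * P.w - P.Q t) * Real.sin θ ^ 2

/-- The same constant bounds the field and is a Lipschitz constant for it in θ; being nonzero, it
can stand in the denominator of the Gronwall bound. -/
theorem exists_coeff_bound (lam : ℝ) :
    ∃ L : ℝ, 1 ≤ L ∧ ∀ t ∈ Icc P.a P.b, P.p + |lam * P.w - P.Q t| ≤ L := by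
  obtain ⟨C, hC⟩ := isCompact_Icc.exists_bound_of_continuousOn
    (f := fun t => lam * P.w - P.Q t) (continuousOn_const.sub P.cont)
  refine ⟨max 1 (P.p + C), le_max_left _ _, fun t ht => le_max_of_le_right ?_⟩
  have := hC t ht
  rw [Real.norm_eq_abs] at this
  linarith

theorem abs_field_le {lam L t : ℝ} (hL : P.p + |lam * P.w - P.Q t| ≤ L) (θ : ℝ) :
    |P.field lam t θ| ≤ L := by
  refine le_trans ?_ hL
  unfold field
  refine (abs_add_le _ _).trans ?_
  rw [abs_mul, abs_mul, abs_of_nonneg P.p_nonneg, abs_of_nonneg (sq_nonneg (Real.cos θ)),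
    abs_of_nonneg (sq_nonneg (Real.sin θ))]
  have := Real.cos_sq_le_one θ
  have := Real.sin_sq_le_one θ
  have := P.p_nonneg
  have := abs_nonneg (lam * P.w - P.Q t)
  nlinarith

theorem abs_field_sub_le {lam L t : ℝ} (hL : P.p + |lam * P.w - P.Q t| ≤ L) (x y : ℝ) :
    |P.field lam t x - P.field lam t y| ≤ L * |x - y| := by
  have h : P.field lam t x - P.field lam t y
      = (P.p - (lam * P.w - P.Q t)) * (Real.cos x ^ 2 - Real.cos y ^ 2) := by
    unfold field; rw [Real.sin_sq, Real.sin_sq]; ring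
  rw [h, abs_mul]
  have h1 := abs_cos_sq_sub_le x y
  have h2 := abs_sub P.p (lam * P.w - P.Q t)
  rw [abs_of_nonneg P.p_nonneg] at h2
  exact mul_le_mul (h2.trans hL) h1 (abs_nonneg _) ((abs_nonneg _).trans (h2.trans hL))

theorem field_mono_lam {lam mu : ℝ} (h : lam ≤ mu) (t θ : ℝ) :
    P.field lam t θ ≤ P.field mu t θ := by
  unfold field
  have := P.w_nonneg
  gcongr

theorem field_add_pi (lam t θ : ℝ) : P.field lam t (θ + Real.pi) = P.field lam t θ := by
  simp [field, Real.cos_add_pi, Real.sin_add_pi]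

/-- `θ` is a Prüfer angle of the piece. -/
def IsAngle (lam : ℝ) (θ : ℝ → ℝ) : Prop :=
  ∀ t ∈ Icc P.a P.b, HasDerivWithinAt θ (P.field lam t (θ t)) (Icc P.a P.b) t

theorem exists_isAngle (lam x : ℝ) : ∃ θ : ℝ → ℝ, θ P.a = x ∧ P.IsAngle lam θ := by
  obtain ⟨L, hL1, hL⟩ := P.exists_coeff_bound lam
  have hL0 : 0 ≤ L := by linarith
  have hab : 0 ≤ P.b - P.a := sub_nonneg.2 P.le
  -- The field is bounded by L for all θ, so the ball of radius L (b - a) lets the solution exist on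
  -- the whole interval.
  have key : IsPicardLindelof (P.field lam) (⟨P.a, left_mem_Icc.2 P.le⟩ : Icc P.a P.b) x
      (⟨L, hL0⟩ * ⟨P.b - P.a, hab⟩) 0 ⟨L, hL0⟩ ⟨L, hL0⟩ := by
    refine ⟨?_, ?_, ?_, ?_⟩
    · intro t ht
      refine LipschitzOnWith.of_dist_le_mul fun u _ v _ => ?_
      rw [Real.dist_eq, Real.dist_eq]
      exact P.abs_field_sub_le (hL t ht) u v
    · intro u _
      unfold field
      have := P.cont
      fun_prop
    · intro t ht u _
      exact P.abs_field_le (hL t ht) u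
    · simp only [sub_self, NNReal.coe_zero, sub_zero, max_eq_left hab]
      exact le_rfl
  exact key.exists_eq_forall_mem_Icc_hasDerivWithinAt₀

variable {P}

theorem IsAngle.continuousOn {lam : ℝ} {θ : ℝ → ℝ} (h : P.IsAngle lam θ) :
    ContinuousOn θ (Icc P.a P.b) := fun t ht => (h t ht).continuousWithinAt

/-- For a subsolution α and a supersolution β the Lipschitz bound gives (β - α)' ≥ -L |β - α|. The
rigidity in the case of equal end values is the source of all strict inequalities. -/
theorem compare {lam : ℝ} {α β α' β' : ℝ → ℝ}
    (hα : ∀ t ∈ Icc P.a P.b, HasDerivWithinAt α (α' t) (Icc P.a P.b) t)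
    (hβ : ∀ t ∈ Icc P.a P.b, HasDerivWithinAt β (β' t) (Icc P.a P.b) t)
    (hα' : ∀ t ∈ Icc P.a P.b, α' t ≤ P.field lam t (α t))
    (hβ' : ∀ t ∈ Icc P.a P.b, P.field lam t (β t) ≤ β' t) (h : α P.a ≤ β P.a) :
    α P.b ≤ β P.b ∧ (α P.b = β P.b → ∀ t ∈ Icc P.a P.b, α t = β t) := by
  obtain ⟨L, hL1, hL⟩ := P.exists_coeff_bound lam
  have hd : ContinuousOn (fun t => β t - α t) (Icc P.a P.b) :=
    fun t ht => ((hβ t ht).sub (hα t ht)).continuousWithinAt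
  have hd' : ∀ t ∈ Ioo P.a P.b, HasDerivAt (fun t => β t - α t) (β' t - α' t) t := fun t ht =>
    ((hβ t (Ioo_subset_Icc_self ht)).sub (hα t (Ioo_subset_Icc_self ht))).hasDerivAt
      (Icc_mem_nhds ht.1 ht.2)
  have hle : ∀ t ∈ Ioo P.a P.b, -(L * |β t - α t|) ≤ β' t - α' t := fun t ht => by
    have ht := Ioo_subset_Icc_self ht
    have h1 := neg_le_of_abs_le (P.abs_field_sub_le (hL t ht) (β t) (α t))
    have h2 := hα' t ht
    have h3 := hβ' t ht
    linarith
  constructor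
  · exact sub_nonneg.1 (nonneg_of_neg_mul_abs_le_deriv hd hd' hle (sub_nonneg.2 h)
      (right_mem_Icc.2 P.le))
  · intro he t ht
    exact (sub_eq_zero.1 (eq_zero_of_neg_mul_abs_le_deriv hd hd' hle (sub_nonneg.2 h)
      (sub_eq_zero.2 he.symm) ht)).symm

variable (P)

/-- The Prüfer angle with the initial value `x`. -/
noncomputable def angle (lam x : ℝ) : ℝ → ℝ := (P.exists_isAngle lam x).choose

/-- The terminal value of the Prüfer angle with the initial value `x`. -/
noncomputable def flow (lam x : ℝ) : ℝ := P.angle lam x P.b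

theorem angle_left (lam x : ℝ) : P.angle lam x P.a = x := (P.exists_isAngle lam x).choose_spec.1

theorem isAngle_angle (lam x : ℝ) : P.IsAngle lam (P.angle lam x) :=
  (P.exists_isAngle lam x).choose_spec.2

variable {P}

theorem le_flow {lam x : ℝ} {α α' : ℝ → ℝ}
    (hα : ∀ t ∈ Icc P.a P.b, HasDerivWithinAt α (α' t) (Icc P.a P.b) t)
    (hα' : ∀ t ∈ Icc P.a P.b, α' t ≤ P.field lam t (α t)) (h : α P.a ≤ x) :
    α P.b ≤ P.flow lam x :=
  (compare hα (P.isAngle_angle lam x) hα' (fun _ _ => le_rfl) (by rwa [angle_left])).1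

theorem flow_le {lam x : ℝ} {β β' : ℝ → ℝ}
    (hβ : ∀ t ∈ Icc P.a P.b, HasDerivWithinAt β (β' t) (Icc P.a P.b) t)
    (hβ' : ∀ t ∈ Icc P.a P.b, P.field lam t (β t) ≤ β' t) (h : x ≤ β P.a) :
    P.flow lam x ≤ β P.b :=
  (compare (P.isAngle_angle lam x) hβ (fun _ _ => le_rfl) hβ' (by rwa [angle_left])).1

/-- Uniqueness: a Prüfer angle is both a subsolution and a supersolution. -/
theorem flow_eq {lam : ℝ} {θ : ℝ → ℝ} (h : P.IsAngle lam θ) : P.flow lam (θ P.a) = θ P.b :=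
  le_antisymm (flow_le h (fun _ _ => le_rfl) le_rfl) (le_flow h (fun _ _ => le_rfl) le_rfl)

theorem flow_compare {lam mu x y : ℝ} (hl : lam ≤ mu) (hx : x ≤ y) :
    P.flow lam x ≤ P.flow mu y ∧ (P.flow lam x = P.flow mu y →
      ∀ t ∈ Icc P.a P.b, P.angle lam x t = P.angle mu y t) :=
  compare (P.isAngle_angle lam x) (P.isAngle_angle mu y)
    (fun t _ => P.field_mono_lam hl t _) (fun _ _ => le_rfl) (by rwa [angle_left, angle_left])

theorem flow_mono {lam mu x y : ℝ} (hl : lam ≤ mu) (hx : x ≤ y) :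
    P.flow lam x ≤ P.flow mu y := (flow_compare hl hx).1

theorem flow_lt_flow {lam mu x y : ℝ} (hl : lam ≤ mu) (hx : x < y) :
    P.flow lam x < P.flow mu y := by
  have h := flow_compare (P := P) hl hx.le
  refine lt_of_le_of_ne h.1 fun he => hx.ne ?_
  simpa [angle_left] using h.2 he P.a (left_mem_Icc.2 P.le)

/-- If the end values agree, the two angles coincide, and subtracting their equations leaves (mu -
lam) w sin²θ = 0. But sin θ cannot vanish on the open interval: if p > 0, the angle moves with speed
p at multiples of π; otherwise continuity at the left end contradicts sin x ≠ 0. -/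
theorem flow_lt_flow_of_lam {lam mu x y : ℝ} (hl : lam < mu) (hxy : x ≤ y) (hab : P.a < P.b)
    (hw : 0 < P.w) (hp : 0 < P.p ∨ Real.sin x ≠ 0) : P.flow lam x < P.flow mu y := by
  have h := flow_compare (P := P) hl.le hxy
  refine lt_of_le_of_ne h.1 fun he => ?_
  have heq := h.2 he
  set θ := P.angle lam x
  have hθ := P.isAngle_angle lam x
  have hsin : ∀ t ∈ Ioo P.a P.b, Real.sin (θ t) = 0 := by
    intro t ht
    have h1 := (hθ t (Ioo_subset_Icc_self ht)).hasDerivAt (Icc_mem_nhds ht.1 ht.2)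
    have h2 := ((P.isAngle_angle mu y) t (Ioo_subset_Icc_self ht)).hasDerivAt
      (Icc_mem_nhds ht.1 ht.2)
    have h3 : θ =ᶠ[𝓝 t] P.angle mu y := by
      filter_upwards [Icc_mem_nhds ht.1 ht.2] with s hs using heq s hs
    have h4 := h1.unique (h2.congr_of_eventuallyEq h3)
    rw [← heq t (Ioo_subset_Icc_self ht)] at h4
    change P.field lam t (θ t) = P.field mu t (θ t) at h4
    unfold field at h4
    have h5 : (mu - lam) * P.w * Real.sin (θ t) ^ 2 = 0 := by linarith
    have h6 : (mu - lam) * P.w ≠ 0 := (mul_pos (sub_pos.2 hl) hw).ne'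
    simpa using (mul_eq_zero.1 h5).resolve_left h6
  rcases hp with hp | hp
  · obtain ⟨t, ht⟩ := nonempty_Ioo.2 hab
    have h1 := (hθ t (Ioo_subset_Icc_self ht)).hasDerivAt (Icc_mem_nhds ht.1 ht.2)
    have h2 : (fun s => Real.sin (θ s)) =ᶠ[𝓝 t] fun _ => 0 := by
      filter_upwards [Ioo_mem_nhds ht.1 ht.2] with s hs using hsin s hs
    have h3 := h1.sin.unique ((hasDerivAt_const t (0 : ℝ)).congr_of_eventuallyEq h2)
    have h4 : Real.sin (θ t) = 0 := hsin t ht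
    have h5 := Real.sin_sq_add_cos_sq (θ t)
    change Real.cos (θ t) * P.field lam t (θ t) = 0 at h3
    have h6 : Real.cos (θ t) ^ 2 = 1 := by rw [h4] at h5; linarith
    unfold field at h3
    rw [h4, h6] at h3
    have h7 : Real.cos (θ t) = 0 := by
      simpa [hp.ne'] using h3
    rw [h7] at h6
    norm_num at h6
  · apply hp
    have hc : ContinuousOn (fun t => Real.sin (θ t)) (Icc P.a P.b) :=
      Real.continuous_sin.comp_continuousOn hθ.continuousOn
    have h1 : ContinuousWithinAt (fun t => Real.sin (θ t)) (Ioo P.a P.b) P.a :=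
      (hc P.a (left_mem_Icc.2 hab.le)).mono Ioo_subset_Icc_self
    have h2 := h1.mem_closure (t := {0}) (by rw [closure_Ioo hab.ne]; exact left_mem_Icc.2 hab.le)
      (fun t ht => hsin t ht)
    simpa [θ, angle_left] using h2

theorem flow_add_pi (lam x : ℝ) : P.flow lam (x + Real.pi) = P.flow lam x + Real.pi := by
  have h : P.IsAngle lam (fun t => P.angle lam x t + Real.pi) := fun t ht => by
    simpa [field_add_pi] using (P.isAngle_angle lam x t ht).add_const Real.pi
  simpa [angle_left, flow] using flow_eq h

theorem flow_add_nat_mul_pi (lam x : ℝ) (k : ℕ) :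
    P.flow lam (x + k * Real.pi) = P.flow lam x + k * Real.pi := by
  induction k with
  | zero => simp
  | succ k ih =>
    have h1 : x + ((k + 1 : ℕ) : ℝ) * Real.pi = x + k * Real.pi + Real.pi := by push_cast; ring
    rw [h1, flow_add_pi, ih]; push_cast; ring

theorem flow_of_eq (h : P.a = P.b) (lam x : ℝ) : P.flow lam x = x := by
  unfold flow; rw [← h, angle_left]

theorem le_flow_zero (lam : ℝ) : 0 ≤ P.flow lam 0 :=
  le_flow (α := fun _ => 0) (fun t _ => hasDerivWithinAt_const t _ 0)
    (fun t _ => by simp [field, P.p_nonneg]) le_rfl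

theorem flow_zero_pos (hp : 0 < P.p) (hab : P.a < P.b) (lam : ℝ) : 0 < P.flow lam 0 := by
  have hθ := P.isAngle_angle lam 0
  have h := compare (P := P) (lam := lam) (α := fun _ => 0)
    (fun t _ => hasDerivWithinAt_const t _ 0) hθ
    (fun t _ => by simp [field, P.p_nonneg]) (fun _ _ => le_rfl) (by rw [angle_left])
  refine lt_of_le_of_ne h.1 fun he => ?_
  obtain ⟨t, ht⟩ := nonempty_Ioo.2 hab
  have h1 := (hθ t (Ioo_subset_Icc_self ht)).hasDerivAt (Icc_mem_nhds ht.1 ht.2)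
  have h2 : P.angle lam 0 =ᶠ[𝓝 t] fun _ => 0 := by
    filter_upwards [Icc_mem_nhds ht.1 ht.2] with s hs using (h.2 he s hs).symm
  have h3 := h1.unique ((hasDerivAt_const t (0 : ℝ)).congr_of_eventuallyEq h2)
  rw [h2.eq_of_nhds] at h3
  simp [field, hp.ne'] at h3

/-- At multiples of π the field equals p ≥ 0, whatever λ is, so they can be crossed only upwards. -/
theorem nat_mul_pi_le_flow {lam x : ℝ} {k : ℕ} (h : k * Real.pi ≤ x) :
    k * Real.pi ≤ P.flow lam x := by
  have h1 := flow_mono (P := P) (le_refl lam) h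
  have h2 := flow_add_nat_mul_pi (P := P) lam 0 k
  rw [zero_add] at h2
  have := le_flow_zero (P := P) lam
  linarith

theorem nat_mul_pi_lt_flow {lam x : ℝ} {k : ℕ} (hp : 0 < P.p) (hab : P.a < P.b)
    (h : k * Real.pi ≤ x) : k * Real.pi < P.flow lam x := by
  have h1 := flow_mono (P := P) (le_refl lam) h
  have h2 := flow_add_nat_mul_pi (P := P) lam 0 k
  rw [zero_add] at h2
  have := flow_zero_pos (P := P) hp hab lam
  linarith

/-- At π/2 the field is λ w - Q ≤ 0, so the constant π/2 is a supersolution. -/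
theorem flow_le_pi_div_two {lam x : ℝ} (h : ∀ t ∈ Icc P.a P.b, lam * P.w ≤ P.Q t)
    (hx : x ≤ Real.pi / 2) : P.flow lam x ≤ Real.pi / 2 :=
  flow_le (β := fun _ => Real.pi / 2) (fun t _ => hasDerivWithinAt_const t _ _)
    (fun t ht => by simpa [field] using h t ht) hx

/-- Without angular velocity on the `y`-axis the points of `π ℤ` are fixed. -/
theorem flow_nat_mul_pi (hp : P.p = 0) (lam : ℝ) (k : ℕ) :
    P.flow lam (k * Real.pi) = k * Real.pi := by
  have : P.IsAngle lam (fun _ => k * Real.pi) := fun t _ => by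
    simpa [field, hp] using hasDerivWithinAt_const t _ _
  exact flow_eq this

/-- Gronwall: an angle for another parameter mu solves the equation for `lam` up to the error |mu -
lam| w, because sin² ≤ 1. -/
theorem continuous_flow : Continuous fun x : ℝ × ℝ => P.flow x.1 x.2 := by
  rw [continuous_iff_continuousAt]
  rintro ⟨lam, x⟩
  obtain ⟨L, hL1, hL⟩ := P.exists_coeff_bound lam
  have hL0 : 0 ≤ L := by linarith
  have hIci : ∀ {mu y : ℝ}, ∀ t ∈ Ico P.a P.b,
      HasDerivWithinAt (P.angle mu y) (P.field mu t (P.angle mu y t)) (Ici t) t :=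
    fun {mu y} t ht => (P.isAngle_angle mu y t (Ico_subset_Icc_self ht)).mono_of_mem_nhdsWithin
      (Icc_mem_nhdsGE_of_mem ht)
  have hbound : ∀ z : ℝ × ℝ, dist (P.flow z.1 z.2) (P.flow lam x) ≤
      gronwallBound (dist z.2 x) L (|z.1 - lam| * P.w) (P.b - P.a) := by
    rintro ⟨mu, y⟩
    have h := dist_le_of_approx_trajectories_ODE_of_mem (v := P.field lam) (s := fun _ => univ)
      (K := ⟨L, hL0⟩) (a := P.a) (b := P.b) (f := P.angle mu y) (g := P.angle lam x)
      (εf := |mu - lam| * P.w) (εg := 0) (δ := dist y x)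
      (fun t ht => LipschitzOnWith.of_dist_le_mul fun u _ v _ => by
        rw [Real.dist_eq, Real.dist_eq]
        exact P.abs_field_sub_le (hL t (Ico_subset_Icc_self ht)) u v)
      (P.isAngle_angle mu y).continuousOn hIci
      (fun t _ => by
        rw [Real.dist_eq]
        have : P.field mu t (P.angle mu y t) - P.field lam t (P.angle mu y t)
            = (mu - lam) * P.w * Real.sin (P.angle mu y t) ^ 2 := by unfold field; ring
        rw [this, abs_mul, abs_mul, abs_of_nonneg P.w_nonneg,
          abs_of_nonneg (sq_nonneg (Real.sin _))]
        exact mul_le_of_le_one_right (mul_nonneg (abs_nonneg _) P.w_nonneg)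
          (Real.sin_sq_le_one _))
      (fun _ _ => trivial) (P.isAngle_angle lam x).continuousOn hIci
      (fun t _ => by rw [dist_self]) (fun _ _ => trivial)
      (by rw [angle_left, angle_left]) P.b (right_mem_Icc.2 P.le)
    rw [add_zero] at h
    exact h
  refine tendsto_iff_dist_tendsto_zero.2 (squeeze_zero (fun _ => dist_nonneg) hbound ?_)
  have hK : L ≠ 0 := by linarith
  simp only [gronwallBound_of_K_ne_0 hK]
  have : Continuous fun z : ℝ × ℝ => dist z.2 x * Real.exp (L * (P.b - P.a)) +
      |z.1 - lam| * P.w / L * (Real.exp (L * (P.b - P.a)) - 1) := by fun_prop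
  simpa using this.tendsto (lam, x)

/-- A `C¹` curve that is slower than the Prüfer angle at its passages through `π ℤ` is overtaken by
the Prüfer angle for large `λ`. -/
theorem exists_lam_le_flow {α α' : ℝ → ℝ} (hw : 0 < P.w)
    (hα : ∀ t ∈ Icc P.a P.b, HasDerivWithinAt α (α' t) (Icc P.a P.b) t)
    (hα' : ContinuousOn α' (Icc P.a P.b))
    (h : ∀ t ∈ Icc P.a P.b, Real.sin (α t) = 0 → α' t < P.p * Real.cos (α t) ^ 2) :
    ∃ Λ : ℝ, ∀ lam ≥ Λ, ∀ x, α P.a ≤ x → α P.b ≤ P.flow lam x := by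
  have hαc : ContinuousOn α (Icc P.a P.b) := fun t ht => (hα t ht).continuousWithinAt
  have hf : ContinuousOn (fun t => P.p * Real.cos (α t) ^ 2 - α' t) (Icc P.a P.b) := by fun_prop
  have hs : ContinuousOn (fun t => Real.sin (α t) ^ 2) (Icc P.a P.b) := by fun_prop
  obtain ⟨C, hC⟩ := isCompact_Icc.exists_bound_of_continuousOn hf
  obtain ⟨D, hD⟩ := isCompact_Icc.exists_bound_of_continuousOn P.cont
  -- On this compact set, where the term p cos²α alone does not reach α', sin α has no zero; so
  -- sin²α ≥ m > 0 there and a large λ makes up the deficit, which is at most |C|. Elsewhere λ w ≥ Q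
  -- suffices.
  have hK : IsCompact (Icc P.a P.b ∩ (fun t => P.p * Real.cos (α t) ^ 2 - α' t) ⁻¹' Iic 0) :=
    isCompact_Icc.of_isClosed_subset (hf.preimage_isClosed_of_isClosed isClosed_Icc isClosed_Iic)
      inter_subset_left
  obtain ⟨m, hm, hmK⟩ : ∃ m : ℝ, 0 < m ∧ ∀ t ∈ Icc P.a P.b,
      P.p * Real.cos (α t) ^ 2 - α' t ≤ 0 → m ≤ Real.sin (α t) ^ 2 := by
    rcases (Icc P.a P.b ∩ (fun t => P.p * Real.cos (α t) ^ 2 - α' t) ⁻¹' Iic 0).eq_empty_or_nonempty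
      with he | hne
    · exact ⟨1, one_pos, fun t ht h0 => (he.subset ⟨ht, h0⟩).elim⟩
    · obtain ⟨t₀, ht₀, hmin⟩ := hK.exists_isMinOn hne (hs.mono inter_subset_left)
      refine ⟨Real.sin (α t₀) ^ 2, ?_, fun t ht h0 => hmin ⟨ht, h0⟩⟩
      have : Real.sin (α t₀) ≠ 0 := fun h0 => by
        have h1 := h t₀ ht₀.1 h0
        have h2 : P.p * Real.cos (α t₀) ^ 2 - α' t₀ ≤ 0 := ht₀.2
        linarith
      positivity
  refine ⟨(|C| / m + |D|) / P.w, fun lam hlam x hx => le_flow hα (fun t ht => ?_) hx⟩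
  have h1 : |C| / m + |D| ≤ lam * P.w := (div_le_iff₀ hw).1 hlam
  have h2 := (le_abs_self _).trans ((hD t ht).trans (le_abs_self D))
  have h3 : |C| / m ≤ lam * P.w - P.Q t := by linarith
  have h4 : 0 ≤ |C| / m := by positivity
  unfold field
  rcases le_or_gt (P.p * Real.cos (α t) ^ 2 - α' t) 0 with h5 | h5
  · have h6 := hmK t ht h5
    have h7 := neg_le_of_abs_le ((hC t ht).trans (le_abs_self C))
    have h8 : |C| / m * m ≤ (lam * P.w - P.Q t) * Real.sin (α t) ^ 2 := by gcongr; linarith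
    rw [div_mul_cancel₀ _ hm.ne'] at h8
    linarith
  · have : 0 ≤ (lam * P.w - P.Q t) * Real.sin (α t) ^ 2 :=
      mul_nonneg (h4.trans h3) (sq_nonneg _)
    linarith

end Piece

/-! ### From the angle back to the linear system -/

theorem exists_hasDerivWithinAt_Icc {f : ℝ → ℝ} {a b : ℝ} (hab : a ≤ b)
    (hf : ContinuousOn f (Icc a b)) :
    ∃ F : ℝ → ℝ, F a = 0 ∧ ∀ t ∈ Icc a b, HasDerivWithinAt F (f t) (Icc a b) t := by
  have hc : Continuous (IccExtend hab ((Icc a b).domRestrict f)) :=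
    (continuousOn_iff_continuous_domRestrict.1 hf).Icc_extend'
  refine ⟨fun t => ∫ s in a..t, IccExtend hab ((Icc a b).domRestrict f) s, by simp, fun t ht => ?_⟩
  have h := (hc.integral_hasStrictDerivAt a t).hasDerivAt.hasDerivWithinAt (s := Icc a b)
  rw [IccExtend_of_mem hab _ ht] at h
  exact h

theorem eq_add_mul_of_hasDerivWithinAt_const {f : ℝ → ℝ} {a b c : ℝ}
    (hf : ∀ t ∈ Icc a b, HasDerivWithinAt f c (Icc a b) t) {t : ℝ} (ht : t ∈ Icc a b) :
    f t = f a + c * (t - a) := by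
  have h : ∀ t ∈ Icc a b, HasDerivWithinAt (fun t => f t - c * (t - a)) 0 (Icc a b) t := by
    intro t ht
    have h2 : HasDerivWithinAt (fun t => c * (t - a)) (c * 1) (Icc a b) t :=
      (((hasDerivWithinAt_id t _).sub_const a).const_mul c)
    convert! (hf t ht).sub h2 using 1
    ring
  have := constant_of_has_deriv_right_zero (fun t ht => (h t ht).continuousWithinAt)
    (fun t ht => (h t (Ico_subset_Icc_self ht)).mono_of_mem_nhdsWithin
      (Icc_mem_nhdsGE_of_mem ht)) t ht
  simp at this
  linarith

namespace Piece

variable {P : Piece}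

/-- The linear system behind the equation for the Prüfer angle. -/
theorem exists_radius (lam x : ℝ) : ∃ r : ℝ → ℝ, r P.a = 1 ∧ (∀ t, 0 < r t) ∧
    ∀ t ∈ Icc P.a P.b,
      HasDerivWithinAt (fun t => r t * Real.sin (P.angle lam x t))
        (P.p * (r t * Real.cos (P.angle lam x t))) (Icc P.a P.b) t ∧
      HasDerivWithinAt (fun t => r t * Real.cos (P.angle lam x t))
        ((P.Q t - lam * P.w) * (r t * Real.sin (P.angle lam x t))) (Icc P.a P.b) t := by
  set θ := P.angle lam x
  have hθ := P.isAngle_angle lam x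
  have hc : ContinuousOn (fun t => (P.p - (lam * P.w - P.Q t)) *
      (Real.sin (θ t) * Real.cos (θ t))) (Icc P.a P.b) := by
    have := P.cont
    have : ContinuousOn θ (Icc P.a P.b) := hθ.continuousOn
    fun_prop
  -- F is log r: the system forces (log r)' = (p - (λ w - Q)) sin θ cos θ.
  obtain ⟨F, hF0, hF⟩ := exists_hasDerivWithinAt_Icc P.le hc
  refine ⟨fun t => Real.exp (F t), by simp [hF0], fun t => Real.exp_pos _, fun t ht => ?_⟩
  have h1 := (hF t ht).exp
  have h2 := (hθ t ht).sin
  have h3 := (hθ t ht).cos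
  have hsc := Real.sin_sq_add_cos_sq (θ t)
  constructor
  · convert! h1.mul h2 using 1
    change _ = Real.exp (F t) * _ * Real.sin (θ t) + Real.exp (F t) * (Real.cos (θ t) *
      P.field lam t (θ t))
    unfold field
    linear_combination (-P.p * Real.exp (F t) * Real.cos (θ t)) * hsc
  · convert! h1.mul h3 using 1
    change _ = Real.exp (F t) * _ * Real.cos (θ t) + Real.exp (F t) * (-Real.sin (θ t) *
      P.field lam t (θ t))
    unfold field
    linear_combination ((lam * P.w - P.Q t) * Real.exp (F t) * Real.sin (θ t)) * hsc

end Piece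

/-! ### The Prüfer angle along the whole time scale -/

/-- A sequence of disjoint compact intervals `[A i, B i]`, ordered from left to right. -/
structure Components where
  A : ℕ → ℝ
  B : ℕ → ℝ
  le : ∀ i, A i ≤ B i
  lt : ∀ i, B i < A (i + 1)

namespace Components

variable {K : Components}

theorem strictMono_B : StrictMono K.B :=
  strictMono_nat_of_lt_succ fun i => (K.lt i).trans_le (K.le _)

theorem B_lt_A {i j : ℕ} (h : i < j) : K.B i < K.A j := by
  obtain ⟨k, rfl⟩ := Nat.exists_eq_add_of_lt h
  exact (strictMono_B.monotone (by omega)).trans_lt (K.lt (i + k))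

end Components

/-- A potential on a sequence of components. -/
structure Chain extends Components where
  q : ℝ → ℝ
  cont : ∀ i, ContinuousOn q (Icc (A i) (B i))

namespace Chain

variable (C : Chain)

/-- The equation on a component. -/
def seg (i : ℕ) : Piece where
  p := 1
  w := 1
  Q := C.q
  a := C.A i
  b := C.B i
  p_nonneg := zero_le_one
  w_nonneg := zero_le_one
  le := C.le i
  cont := C.cont i

/-- The transition `y ↦ y + h z` across a gap of length `h`. -/
def gapY (i : ℕ) : Piece where
  p := 1
  w := 0
  Q := fun _ => 0
  a := C.B i
  b := C.A (i + 1)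
  p_nonneg := zero_le_one
  w_nonneg := le_rfl
  le := (C.lt i).le
  cont := continuousOn_const

/-- The transition `z ↦ z + h (q - λ) y` across a gap of length `h`. -/
def gapZ (i : ℕ) : Piece where
  p := 0
  w := 1
  Q := fun _ => C.q (C.B i)
  a := C.B i
  b := C.A (i + 1)
  p_nonneg := le_rfl
  w_nonneg := zero_le_one
  le := (C.lt i).le
  cont := continuousOn_const

/-- The Prüfer angle after a component and the first part of the following transition. -/
noncomputable def angleMid (lam x : ℝ) (i : ℕ) : ℝ :=
  (C.gapY i).flow lam ((C.seg i).flow lam x)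

/-- The Prüfer angle at `A i` with the initial value `x` at `A 0`. -/
noncomputable def angle (lam x : ℝ) : ℕ → ℝ
  | 0 => x
  | i + 1 => (C.gapZ i).flow lam (C.angleMid lam (angle lam x i) i)

/-- The Prüfer angle at `B i` with the initial value `x` at `A 0`. -/
noncomputable def endAngle (i : ℕ) (lam x : ℝ) : ℝ := (C.seg i).flow lam (C.angle lam x i)

variable {C}

theorem angle_mono {lam mu x y : ℝ} (hl : lam ≤ mu) (hx : x ≤ y) (i : ℕ) :
    C.angle lam x i ≤ C.angle mu y i := by
  induction i with
  | zero => exact hx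
  | succ i ih => exact Piece.flow_mono hl (Piece.flow_mono hl (Piece.flow_mono hl ih))

theorem angle_lt_succ {lam mu x y : ℝ} (hl : lam ≤ mu) {i : ℕ}
    (h : C.angle lam x i < C.angle mu y i) : C.angle lam x (i + 1) < C.angle mu y (i + 1) :=
  Piece.flow_lt_flow hl (Piece.flow_lt_flow hl (Piece.flow_lt_flow hl h))

theorem angle_lt_of_le {lam mu x y : ℝ} (hl : lam ≤ mu) {i j : ℕ} (hij : i ≤ j)
    (h : C.angle lam x i < C.angle mu y i) : C.angle lam x j < C.angle mu y j := by
  induction j, hij using Nat.le_induction with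
  | base => exact h
  | succ j _ ih => exact angle_lt_succ hl ih

theorem endAngle_lt {lam mu x y : ℝ} (hl : lam ≤ mu) (hx : x < y) (i : ℕ) :
    C.endAngle i lam x < C.endAngle i mu y :=
  Piece.flow_lt_flow hl (angle_lt_of_le hl (Nat.zero_le i) hx)

theorem angle_add_pi (lam x : ℝ) (i : ℕ) :
    C.angle lam (x + Real.pi) i = C.angle lam x i + Real.pi := by
  induction i with
  | zero => rfl
  | succ i ih => simp only [angle, angleMid, ih, Piece.flow_add_pi]

theorem endAngle_add_pi (lam x : ℝ) (i : ℕ) :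
    C.endAngle i lam (x + Real.pi) = C.endAngle i lam x + Real.pi := by
  simp only [endAngle, angle_add_pi, Piece.flow_add_pi]

theorem continuous_angle (x : ℝ) (i : ℕ) : Continuous fun lam => C.angle lam x i := by
  induction i with
  | zero => exact continuous_const
  | succ i ih =>
    exact Piece.continuous_flow.comp (continuous_id.prodMk (Piece.continuous_flow.comp
      (continuous_id.prodMk (Piece.continuous_flow.comp (continuous_id.prodMk ih)))))

theorem continuous_endAngle (x : ℝ) (i : ℕ) : Continuous fun lam => C.endAngle i lam x :=
  Piece.continuous_flow.comp (continuous_id.prodMk (continuous_angle x i))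

/-- The end angle increases strictly with `λ`, provided that the time scale is not a point and that
the initial angle lies in the closed first quadrant. -/
theorem strictMono_endAngle {m : ℕ} (hm : C.A 0 < C.B 0 ∨ 0 < m) {x : ℝ}
    (hx : 0 ≤ x) (hx' : x ≤ Real.pi / 2) : StrictMono fun lam => C.endAngle m lam x := by
  have hpi := Real.pi_pos
  intro lam mu hl
  rcases hm with hm | hm
  · have h0 : (C.seg 0).flow lam x < (C.seg 0).flow mu x :=
      Piece.flow_lt_flow_of_lam hl le_rfl hm one_pos (Or.inl one_pos)
    cases m with
    | zero => exact h0
    | succ m =>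
      exact Piece.flow_lt_flow hl.le (angle_lt_of_le hl.le (Nat.succ_le_succ (Nat.zero_le m))
        (Piece.flow_lt_flow hl.le (Piece.flow_lt_flow hl.le h0)))
  · by_cases h0 : C.A 0 < C.B 0
    · have h0 : (C.seg 0).flow lam x < (C.seg 0).flow mu x :=
        Piece.flow_lt_flow_of_lam hl le_rfl h0 one_pos (Or.inl one_pos)
      exact Piece.flow_lt_flow hl.le (angle_lt_of_le hl.le (by omega : 0 + 1 ≤ m)
        (Piece.flow_lt_flow hl.le (Piece.flow_lt_flow hl.le h0)))
    · have heq : C.A 0 = C.B 0 := le_antisymm (C.le 0) (not_lt.1 h0)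
      have h1 : C.angleMid lam x 0 = (C.gapY 0).flow lam x := by
        rw [angleMid, Piece.flow_of_eq (P := C.seg 0) heq]
      -- When the first component is a point, λ first acts in the second shear, which fixes
      -- multiples of π. The first shear has moved the angle into (0, π/2], where it is sensitive to
      -- λ.
      have h2 : 0 < C.angleMid lam x 0 := by
        rw [h1]
        exact (Piece.flow_zero_pos one_pos (C.lt 0) lam).trans_le (Piece.flow_mono le_rfl hx)
      have h3 : C.angleMid lam x 0 ≤ Real.pi / 2 := by
        rw [h1]
        exact Piece.flow_le_pi_div_two (fun _ _ => by simp [gapY]) hx'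
      have h4 : C.angle lam x 1 < C.angle mu x 1 :=
        Piece.flow_lt_flow_of_lam hl (Piece.flow_mono hl.le (Piece.flow_mono hl.le le_rfl))
          (C.lt 0) one_pos (Or.inr (Real.sin_pos_of_pos_of_lt_pi h2 (by linarith)).ne')
      exact Piece.flow_lt_flow hl.le (angle_lt_of_le hl.le (by omega) h4)

theorem nat_mul_pi_le_angle {lam x : ℝ} {k i j : ℕ} (hij : i ≤ j)
    (h : k * Real.pi ≤ C.angle lam x i) : k * Real.pi ≤ C.angle lam x j := by
  induction j, hij using Nat.le_induction with
  | base => exact h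
  | succ j _ ih =>
    exact Piece.nat_mul_pi_le_flow (Piece.nat_mul_pi_le_flow (Piece.nat_mul_pi_le_flow ih))

theorem angle_nonneg (lam : ℝ) (i : ℕ) : 0 ≤ C.angle lam 0 i := by
  simpa using nat_mul_pi_le_angle (C := C) (k := 0) (x := 0) (lam := lam) (Nat.zero_le i)
    (by simp [angle])

theorem endAngle_pos {m : ℕ} (hm : C.A 0 < C.B 0 ∨ 0 < m) (lam : ℝ) :
    0 < C.endAngle m lam 0 := by
  rcases Nat.eq_zero_or_pos m with rfl | hpos
  · exact Piece.flow_zero_pos one_pos (hm.resolve_right (by omega)) lam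
  · obtain ⟨k, rfl⟩ := Nat.exists_eq_succ_of_ne_zero hpos.ne'
    have h1 : 0 < C.angleMid lam (C.angle lam 0 k) k := by
      simpa [angleMid] using Piece.nat_mul_pi_lt_flow (P := C.gapY k) (k := 0) (lam := lam) one_pos (C.lt k)
        (Piece.nat_mul_pi_le_flow (by simpa using angle_nonneg lam k))
    have h2 : 0 < C.angle lam 0 (k + 1) :=
      (Piece.le_flow_zero lam).trans_lt (Piece.flow_lt_flow (P := C.gapZ k) (le_refl lam) h1)
    exact (Piece.le_flow_zero lam).trans_lt (Piece.flow_lt_flow (P := C.seg (k + 1)) (le_refl lam) h2)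

theorem exists_le_q (m : ℕ) : ∃ c : ℝ, ∀ i ≤ m, ∀ t ∈ Icc (C.A i) (C.B i), c ≤ C.q t := by
  induction m with
  | zero =>
    obtain ⟨D, hD⟩ := isCompact_Icc.exists_bound_of_continuousOn (C.cont 0)
    refine ⟨-D, fun i hi t ht => ?_⟩
    obtain rfl : i = 0 := by omega
    exact neg_le_of_abs_le (hD t ht)
  | succ m ih =>
    obtain ⟨c, hc⟩ := ih
    obtain ⟨D, hD⟩ := isCompact_Icc.exists_bound_of_continuousOn (C.cont (m + 1))
    refine ⟨min c (-D), fun i hi t ht => ?_⟩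
    rcases Nat.lt_or_ge i (m + 1) with h | h
    · exact (min_le_left _ _).trans (hc i (by omega) t ht)
    · obtain rfl : i = m + 1 := by omega
      exact (min_le_right _ _).trans (neg_le_of_abs_le (hD t ht))

/-- For λ below the minimum of q, π/2 is a barrier on every segment and in both shears. -/
theorem exists_endAngle_le_pi_div_two (m : ℕ) :
    ∃ lam, C.endAngle m lam (Real.pi / 2) ≤ Real.pi / 2 := by
  obtain ⟨c, hc⟩ := exists_le_q (C := C) m
  have hseg : ∀ i ≤ m, ∀ x ≤ Real.pi / 2, (C.seg i).flow c x ≤ Real.pi / 2 := fun i hi x hx =>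
    Piece.flow_le_pi_div_two (fun t ht => by simpa [seg] using hc i hi t ht) hx
  have hangle : ∀ i ≤ m, C.angle c (Real.pi / 2) i ≤ Real.pi / 2 := by
    intro i
    induction i with
    | zero => exact fun _ => le_rfl
    | succ i ih =>
      intro hi
      refine Piece.flow_le_pi_div_two (fun t ht => ?_) (Piece.flow_le_pi_div_two
        (fun _ _ => by simp [gapY]) (hseg i (by omega) _ (ih (by omega))))
      simpa [gapZ] using hc i (by omega) (C.B i) (right_mem_Icc.2 (C.le i))
  exact ⟨c, hseg m le_rfl _ (hangle m le_rfl)⟩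

/-- A nondegenerate component makes the end angle unbounded. -/
theorem exists_nat_mul_pi_le_endAngle {m i : ℕ} (him : i ≤ m) (hi : C.A i < C.B i) (k : ℕ) :
    ∃ lam, k * Real.pi ≤ C.endAngle m lam 0 := by
  have hlen : 0 < C.B i - C.A i := sub_pos.2 hi
  -- The curve to be overtaken is α = s - sin(2s)/2 with s linear from 0 to kπ. Its derivative 2 s'
  -- sin² s vanishes whenever α is a multiple of π, where the Prüfer angle has speed 1.
  set s : ℝ → ℝ := fun t => (t - C.A i) * (k * Real.pi / (C.B i - C.A i)) with hs
  have hsd : ∀ t, HasDerivAt s (k * Real.pi / (C.B i - C.A i)) t := fun t => by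
    simpa using ((hasDerivAt_id t).sub_const (C.A i)).mul_const (k * Real.pi / (C.B i - C.A i))
  have hsB : s (C.B i) = k * Real.pi := by simp only [hs]; field_simp
  -- Modulo π this says that 2v = sin(2v) only for v = 0.
  have hsin : ∀ u : ℝ, Real.sin (u - Real.sin (2 * u) / 2) = 0 → Real.sin u = 0 := by
    intro u hu
    obtain ⟨n, hn⟩ := Real.sin_eq_zero_iff.1 hu
    have hv : u - n * Real.pi = Real.sin (2 * (u - n * Real.pi)) / 2 := by
      have : 2 * (u - n * Real.pi) = 2 * u - n * (2 * Real.pi) := by ring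
      rw [this, Real.sin_sub_int_mul_two_pi]; linarith
    have hv0 : u - n * Real.pi = 0 := by
      rcases lt_trichotomy (u - n * Real.pi) 0 with h | h | h
      · have := Real.sin_lt (x := -(2 * (u - n * Real.pi))) (by linarith)
        rw [Real.sin_neg] at this
        linarith
      · exact h
      · have := Real.sin_lt (x := 2 * (u - n * Real.pi)) (by linarith)
        linarith
    rw [sub_eq_zero.1 hv0, Real.sin_int_mul_pi]
  obtain ⟨Λ, hΛ⟩ := Piece.exists_lam_le_flow (P := C.seg i)
    (α := fun t => s t - Real.sin (2 * s t) / 2)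
    (α' := fun t => k * Real.pi / (C.B i - C.A i) * (2 * Real.sin (s t) ^ 2)) one_pos
    (fun t _ => by
      have h1 := ((hsd t).sub ((((hsd t).const_mul 2).sin).div_const 2)).hasDerivWithinAt
        (s := Icc (C.seg i).a (C.seg i).b)
      convert! h1 using 1
      rw [Real.cos_two_mul, Real.cos_sq']
      ring)
    (by
      have hsc : Continuous s := continuous_iff_continuousAt.2 fun t => (hsd t).continuousAt
      exact Continuous.continuousOn (by fun_prop))
    (fun t _ h0 => by
      rw [hsin _ h0, Real.cos_sq', h0]
      simp [seg])
  have h1 := hΛ Λ le_rfl (C.angle Λ 0 i) (by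
    have : s (C.seg i).a = 0 := by simp [hs, seg]
    simp only [this]
    simpa using angle_nonneg Λ i)
  have h2 : k * Real.pi ≤ (C.seg i).flow Λ (C.angle Λ 0 i) := by
    have h3 : s (C.seg i).b = k * Real.pi := hsB
    simp only [h3] at h1
    have h4 : 2 * (k * Real.pi) = ((2 * k : ℕ) : ℝ) * Real.pi := by push_cast; ring
    rw [h4, Real.sin_nat_mul_pi] at h1
    simpa using h1
  refine ⟨Λ, ?_⟩
  rcases him.eq_or_lt with rfl | him
  · exact h2
  · exact Piece.nat_mul_pi_le_flow (nat_mul_pi_le_angle (Nat.succ_le_of_lt him)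
      (Piece.nat_mul_pi_le_flow (Piece.nat_mul_pi_le_flow h2)))

/-! ### Isolated points only -/

section Discrete

variable {m : ℕ}

/-- The first shear fixes π/2 modulo π and the second fixes 0 modulo π. So from at most iπ + π/2 the
first shear stays below (i + 1)π, and the second cannot reach it. -/
theorem endAngle_lt_of_discrete (h : ∀ i ≤ m, C.A i = C.B i) (hm : 0 < m) (lam : ℝ) :
    C.endAngle m lam (Real.pi / 2) < m * Real.pi := by
  have hpi := Real.pi_pos
  have hstep : ∀ i ≤ m, C.angle lam (Real.pi / 2) i ≤ i * Real.pi + Real.pi / 2 →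
      C.angle lam (Real.pi / 2) (i + 1) < (i + 1 : ℕ) * Real.pi := by
    intro i hi hle
    have h1 : C.angleMid lam (C.angle lam (Real.pi / 2) i) i ≤ i * Real.pi + Real.pi / 2 := by
      rw [angleMid, Piece.flow_of_eq (P := C.seg i) (h i hi)]
      refine (Piece.flow_mono le_rfl hle).trans ?_
      have h2 : (C.gapY i).flow lam (Real.pi / 2) ≤ Real.pi / 2 :=
        Piece.flow_le_pi_div_two (fun _ _ => by simp [gapY]) le_rfl
      rw [add_comm (_ * _), Piece.flow_add_nat_mul_pi]
      linarith
    refine (Piece.flow_lt_flow (P := C.gapZ i) (le_refl lam)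
      (y := (i + 1 : ℕ) * Real.pi) (h1.trans_lt ?_)).trans_eq (Piece.flow_nat_mul_pi rfl _ _)
    push_cast
    linarith
  have hind : ∀ i ≤ m, C.angle lam (Real.pi / 2) i ≤ i * Real.pi + Real.pi / 2 := by
    intro i
    induction i with
    | zero => intro _; simp [angle]
    | succ i ih =>
      intro hi
      have := hstep i (by omega) (ih (by omega))
      linarith
  rw [endAngle, Piece.flow_of_eq (h m le_rfl)]
  obtain ⟨k, rfl⟩ := Nat.exists_eq_succ_of_ne_zero hm.ne'
  exact hstep k (by omega) (hind k (by omega))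

/-- A large λ brings the second shear as close as desired to the next multiple of π without reaching
it; the first shear of the following gap then carries the angle across. Each gap thus gains one
multiple of π. -/
theorem exists_lt_angleMid (h : ∀ i ≤ m, C.A i = C.B i) (i : ℕ) (hi : i ≤ m) :
    ∃ lam, i * Real.pi < C.angleMid lam (C.angle lam 0 i) i := by
  have hpi := Real.pi_pos
  induction i with
  | zero =>
    exact ⟨0, by
      rw [angleMid, Piece.flow_of_eq (P := C.seg 0) (h 0 hi)]
      simpa [angle] using Piece.flow_zero_pos (P := C.gapY 0) one_pos (C.lt 0) 0⟩
  | succ i ih =>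
    obtain ⟨lam₀, hlam₀⟩ := ih (by omega)
    have hY : ((i + 1 : ℕ) : ℝ) * Real.pi < (C.gapY (i + 1)).flow lam₀ ((i + 1 : ℕ) * Real.pi) :=
      Piece.nat_mul_pi_lt_flow one_pos (C.lt _) le_rfl
    have hcont : Continuous fun x => (C.gapY (i + 1)).flow lam₀ x :=
      Piece.continuous_flow.comp (continuous_const.prodMk continuous_id)
    -- By continuity the next first shear already carries some x just below (i + 1)π across it.
    obtain ⟨x, hx, hx1, hx2⟩ : ∃ x, ((i + 1 : ℕ) : ℝ) * Real.pi < (C.gapY (i + 1)).flow lam₀ x ∧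
        i * Real.pi < x ∧ x < (i + 1 : ℕ) * Real.pi := by
      have h1 : ∀ᶠ x in 𝓝[<] (((i + 1 : ℕ) : ℝ) * Real.pi),
          ((i + 1 : ℕ) : ℝ) * Real.pi < (C.gapY (i + 1)).flow lam₀ x :=
        nhdsWithin_le_nhds (hcont.continuousAt.eventually (lt_mem_nhds hY))
      have h2 : ∀ᶠ x in 𝓝[<] (((i + 1 : ℕ) : ℝ) * Real.pi), x ∈
          Ioo (i * Real.pi) (((i + 1 : ℕ) : ℝ) * Real.pi) :=
        Ioo_mem_nhdsLT (by push_cast; linarith)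
      obtain ⟨x, hx, hx'⟩ := (h1.and h2).exists
      exact ⟨x, hx, hx'.1, hx'.2⟩
    set c := C.angleMid lam₀ (C.angle lam₀ 0 i) i
    have hlen : 0 < C.A (i + 1) - C.B i := sub_pos.2 (C.lt i)
    -- The line from c' to x is nondecreasing and stays strictly between iπ and (i + 1)π, so the
    -- condition at multiples of π is vacuous.
    set c' := min c x with hc'
    have hc'1 : i * Real.pi < c' := lt_min hlam₀ hx1
    have hc'2 : c' ≤ x := min_le_right _ _
    obtain ⟨Λ, hΛ⟩ := Piece.exists_lam_le_flow (P := C.gapZ i)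
      (α := fun t => c' + (t - C.B i) * ((x - c') / (C.A (i + 1) - C.B i)))
      (α' := fun _ => (x - c') / (C.A (i + 1) - C.B i)) one_pos
      (fun t _ => by
        simpa using ((((hasDerivAt_id t).sub_const (C.B i)).mul_const
          ((x - c') / (C.A (i + 1) - C.B i))).const_add c').hasDerivWithinAt)
      continuousOn_const
      (fun t ht h0 => by
        exfalso
        have ht1 : 0 ≤ t - C.B i := sub_nonneg.2 ht.1
        have ht2 : t - C.B i ≤ C.A (i + 1) - C.B i := sub_le_sub_right ht.2 _
        have hs0 : 0 ≤ (x - c') / (C.A (i + 1) - C.B i) :=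
          div_nonneg (sub_nonneg.2 hc'2) hlen.le
        have hle : (t - C.B i) * ((x - c') / (C.A (i + 1) - C.B i)) ≤ x - c' := by
          calc _ ≤ (C.A (i + 1) - C.B i) * ((x - c') / (C.A (i + 1) - C.B i)) := by gcongr
            _ = x - c' := by field_simp
        have hge := mul_nonneg ht1 hs0
        obtain ⟨n, hn⟩ := Real.sin_eq_zero_iff.1 h0
        have hn1 : (i : ℝ) * Real.pi < n * Real.pi := by linarith
        have hn2 : (n : ℝ) * Real.pi < (i + 1 : ℕ) * Real.pi := by linarith
        have hn3 : (i : ℝ) < n := lt_of_mul_lt_mul_right hn1 hpi.le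
        have hn4 : (n : ℝ) < (i + 1 : ℕ) := lt_of_mul_lt_mul_right hn2 hpi.le
        have hn5 : (i : ℤ) < n := by exact_mod_cast hn3
        have hn6 : n < ((i + 1 : ℕ) : ℤ) := by exact_mod_cast hn4
        push_cast at hn6
        omega)
    refine ⟨max lam₀ Λ, ?_⟩
    have h1 := hΛ (max lam₀ Λ) (le_max_right _ _)
      (C.angleMid (max lam₀ Λ) (C.angle (max lam₀ Λ) 0 i) i) (by
        have : C.B i - C.B i = 0 := sub_self _
        simp only [gapZ, this, zero_mul, add_zero]
        exact (min_le_left _ _).trans (Piece.flow_mono (le_max_left _ _)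
          (Piece.flow_mono (le_max_left _ _) (angle_mono (le_max_left _ _) le_rfl i))))
    have h2 : x ≤ C.angle (max lam₀ Λ) 0 (i + 1) := by
      refine le_trans (le_of_eq ?_) h1
      simp only [gapZ]
      field_simp
      ring
    rw [angleMid, Piece.flow_of_eq (P := C.seg (i + 1)) (h (i + 1) hi)]
    exact hx.trans_le (Piece.flow_mono (le_max_left _ _) h2)

theorem exists_le_endAngle_of_discrete (h : ∀ i ≤ m, C.A i = C.B i) (hm : 0 < m) :
    ∃ lam, ((m - 1 : ℕ) : ℝ) * Real.pi ≤ C.endAngle m lam 0 := by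
  obtain ⟨k, rfl⟩ := Nat.exists_eq_succ_of_ne_zero hm.ne'
  -- Here k = m - 1: the last gap contributes only its first shear, since no first shear follows its
  -- second one.
  obtain ⟨lam, hlam⟩ := exists_lt_angleMid h k (by omega)
  refine ⟨lam, ?_⟩
  rw [endAngle, Piece.flow_of_eq (h _ le_rfl)]
  exact Piece.nat_mul_pi_le_flow hlam.le

end Discrete

end Chain

/-! ### Solutions as a first-order system; reality of eigenvalues -/

namespace Chain

variable {C : Chain}

/-- The equation on the first `m + 1` components, as a system for `y` and `z = y^Δ`. -/
structure IsSol (C : Chain) (m : ℕ) (lam : ℂ) (y z : ℝ → ℂ) : Prop where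
  contY : ∀ i ≤ m, ContinuousOn y (Icc (C.A i) (C.B i))
  contZ : ∀ i ≤ m, ContinuousOn z (Icc (C.A i) (C.B i))
  derivY : ∀ i ≤ m, ∀ t ∈ Ico (C.A i) (C.B i),
    HasDerivWithinAt y (z t) (Icc (C.A i) (C.B i)) t
  derivZ : ∀ i ≤ m, ∀ t ∈ Ico (C.A i) (C.B i),
    HasDerivWithinAt z ((C.q t - lam) * y t) (Icc (C.A i) (C.B i)) t
  jumpY : ∀ i < m, y (C.A (i + 1)) = y (C.B i) + ((C.A (i + 1) - C.B i : ℝ) : ℂ) * z (C.B i)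
  jumpZ : ∀ i < m, z (C.A (i + 1)) =
    z (C.B i) + ((C.A (i + 1) - C.B i : ℝ) : ℂ) * ((C.q (C.B i) - lam) * y (C.A (i + 1)))

namespace IsSol

variable {m : ℕ} {lam : ℂ} {y z : ℝ → ℂ}

theorem sub_const_mul {y' z' : ℝ → ℂ} (h : C.IsSol m lam y z) (h' : C.IsSol m lam y' z') (c : ℂ) :
    C.IsSol m lam (fun t => y t - c * y' t) (fun t => z t - c * z' t) where
  contY i hi := (h.contY i hi).sub (continuousOn_const.mul (h'.contY i hi))
  contZ i hi := (h.contZ i hi).sub (continuousOn_const.mul (h'.contZ i hi))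
  derivY i hi t ht := (h.derivY i hi t ht).sub ((h'.derivY i hi t ht).const_mul c)
  derivZ i hi t ht := by
    convert! (h.derivZ i hi t ht).sub ((h'.derivZ i hi t ht).const_mul c) using 1
    ring
  jumpY i hi := by rw [h.jumpY i hi, h'.jumpY i hi]; ring
  jumpZ i hi := by rw [h.jumpZ i hi, h'.jumpZ i hi]; ring

theorem eq_zero_on_component (h : C.IsSol m lam y z) {i : ℕ} (hi : i ≤ m)
    (hy : y (C.A i) = 0) (hz : z (C.A i) = 0) {t : ℝ} (ht : t ∈ Icc (C.A i) (C.B i)) :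
    y t = 0 ∧ z t = 0 := by
  obtain ⟨D, hD⟩ := isCompact_Icc.exists_bound_of_continuousOn
    (f := fun t => (C.q t : ℂ) - lam)
    ((Complex.continuous_ofReal.comp_continuousOn (C.cont i)).sub continuousOn_const)
  have key := eq_zero_of_abs_deriv_le_mul_abs_self_of_eq_zero_right (a := C.A i) (b := C.B i)
    (f := fun t => (y t, z t)) (f' := fun t => (z t, (C.q t - lam) * y t)) (K := max 1 D)
    ((h.contY i hi).prodMk (h.contZ i hi))
    (fun t ht => ((h.derivY i hi t ht).prodMk (h.derivZ i hi t ht)).mono_of_mem_nhdsWithin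
      (Icc_mem_nhdsGE_of_mem ht))
    (by simp [hy, hz])
    (fun t ht => by
      have hDt := hD t (Ico_subset_Icc_self ht)
      have h1 : ‖z t‖ ≤ ‖(y t, z t)‖ := norm_snd_le (y t, z t)
      have h2 : ‖y t‖ ≤ ‖(y t, z t)‖ := norm_fst_le (y t, z t)
      rw [Prod.norm_def]
      refine max_le ?_ ?_
      · calc ‖z t‖ ≤ 1 * ‖(y t, z t)‖ := by rw [one_mul]; exact h1
          _ ≤ _ := by gcongr; exact le_max_left _ _
      · calc ‖(C.q t - lam) * y t‖ = ‖(C.q t : ℂ) - lam‖ * ‖y t‖ := norm_mul _ _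
          _ ≤ max 1 D * ‖(y t, z t)‖ := by
            gcongr
            exact hDt.trans (le_max_right _ _)) t ht
  simpa using key

theorem eq_zero (h : C.IsSol m lam y z) (hy : y (C.A 0) = 0) (hz : z (C.A 0) = 0) :
    ∀ i ≤ m, ∀ t ∈ Icc (C.A i) (C.B i), y t = 0 ∧ z t = 0 := by
  intro i
  induction i with
  | zero => exact fun hi t ht => h.eq_zero_on_component hi hy hz ht
  | succ i ih =>
    intro hi t ht
    obtain ⟨h1, h2⟩ := ih (by omega) (C.B i) (right_mem_Icc.2 (C.le i))
    have h3 : y (C.A (i + 1)) = 0 := by rw [h.jumpY i (by omega), h1, h2]; simp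
    exact h.eq_zero_on_component hi h3 (by rw [h.jumpZ i (by omega), h2, h3]; simp) ht

/-- The Lagrange identity forces the eigenvalues to be real. -/
theorem im_eq_zero (h : C.IsSol m lam y z) (hm : C.A 0 < C.B 0 ∨ 0 < m)
    (h0 : y (C.A 0) = 0 ∨ z (C.A 0) = 0) (h1 : y (C.B m) = 0)
    (hne : ∃ i ≤ m, ∃ t ∈ Icc (C.A i) (C.B i), y t ≠ 0) : lam.im = 0 := by
  by_contra hlam
  obtain ⟨i, hi, t, ht, hyt⟩ := hne
  apply hyt
  -- E = -Im λ · Im(ȳ z). The extra factor -Im λ makes E nondecreasing for either sign of Im λ. Both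
  -- boundary conditions make it 0, so it stays 0 and y vanishes.
  set E : ℝ → ℝ := fun t => -lam.im * ((y t).re * (z t).im - (y t).im * (z t).re) with hE
  have hlam2 : 0 < lam.im ^ 2 := by positivity
  have hEderiv : ∀ i ≤ m, ∀ t ∈ Ioo (C.A i) (C.B i),
      HasDerivAt E (lam.im ^ 2 * Complex.normSq (y t)) t := by
    intro i hi t ht
    have hy := (h.derivY i hi t (Ioo_subset_Ico_self ht)).hasDerivAt (Icc_mem_nhds ht.1 ht.2)
    have hz := (h.derivZ i hi t (Ioo_subset_Ico_self ht)).hasDerivAt (Icc_mem_nhds ht.1 ht.2)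
    have hyr := Complex.reCLM.hasFDerivAt.comp_hasDerivAt t hy
    have hyi := Complex.imCLM.hasFDerivAt.comp_hasDerivAt t hy
    have hzr := Complex.reCLM.hasFDerivAt.comp_hasDerivAt t hz
    have hzi := Complex.imCLM.hasFDerivAt.comp_hasDerivAt t hz
    convert! ((hyr.mul hzi).sub (hyi.mul hzr)).const_mul (-lam.im) using 1
    simp [Complex.normSq_apply]
    ring
  have hEmono : ∀ i ≤ m, MonotoneOn E (Icc (C.A i) (C.B i)) := fun i hi =>
    monotoneOn_Icc_of_hasDerivAt (by
      have h1 : ContinuousOn (fun t => (y t).re) (Icc (C.A i) (C.B i)) :=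
        Complex.continuous_re.comp_continuousOn (h.contY i hi)
      have h2 : ContinuousOn (fun t => (y t).im) (Icc (C.A i) (C.B i)) :=
        Complex.continuous_im.comp_continuousOn (h.contY i hi)
      have h3 : ContinuousOn (fun t => (z t).re) (Icc (C.A i) (C.B i)) :=
        Complex.continuous_re.comp_continuousOn (h.contZ i hi)
      have h4 : ContinuousOn (fun t => (z t).im) (Icc (C.A i) (C.B i)) :=
        Complex.continuous_im.comp_continuousOn (h.contZ i hi)
      exact continuousOn_const.mul ((h1.mul h4).sub (h2.mul h3))) (hEderiv i hi)
      (fun t _ => mul_nonneg (sq_nonneg _) (Complex.normSq_nonneg _))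
  have hEAB : ∀ i ≤ m, E (C.A i) ≤ E (C.B i) := fun i hi =>
    hEmono i hi (left_mem_Icc.2 (C.le i)) (right_mem_Icc.2 (C.le i)) (C.le i)
  have hjump : ∀ i < m, E (C.A (i + 1)) = E (C.B i) +
      lam.im ^ 2 * (C.A (i + 1) - C.B i) * Complex.normSq (y (C.A (i + 1))) := by
    intro i hi
    have hyr : (y (C.B i)).re
        = (y (C.A (i + 1))).re - (C.A (i + 1) - C.B i) * (z (C.B i)).re := by
      rw [h.jumpY i hi, Complex.add_re, Complex.re_ofReal_mul]; ring
    have hyi : (y (C.B i)).im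
        = (y (C.A (i + 1))).im - (C.A (i + 1) - C.B i) * (z (C.B i)).im := by
      rw [h.jumpY i hi, Complex.add_im, Complex.im_ofReal_mul]; ring
    simp only [hE]
    rw [hyr, hyi, h.jumpZ i hi, Complex.add_re, Complex.add_im, Complex.re_ofReal_mul,
      Complex.im_ofReal_mul, Complex.normSq_apply, Complex.mul_re, Complex.mul_im]
    simp
    ring
  have hEBA : ∀ i < m, E (C.B i) ≤ E (C.A (i + 1)) := fun i hi => by
    rw [hjump i hi]
    have := sub_pos.2 (C.lt i)
    have := Complex.normSq_nonneg (y (C.A (i + 1)))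
    have : 0 ≤ lam.im ^ 2 * (C.A (i + 1) - C.B i) * Complex.normSq (y (C.A (i + 1))) := by
      positivity
    linarith
  have hA : ∀ i ≤ m, 0 ≤ E (C.A i) := by
    intro i
    induction i with
    | zero => rcases h0 with h0 | h0 <;> simp [hE, h0]
    | succ i ih =>
      exact fun hi => (ih (by omega)).trans ((hEAB i (by omega)).trans (hEBA i (by omega)))
  have hB : ∀ k i, i + k = m → E (C.B i) ≤ 0 := by
    intro k
    induction k with
    | zero =>
      intro i hi
      rw [add_zero] at hi
      simp [hE, hi, h1]
    | succ k ih =>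
      intro i hi
      exact (hEBA i (by omega)).trans ((hEAB (i + 1) (by omega)).trans (ih (i + 1) (by omega)))
  have hyA : ∀ i < m, y (C.A (i + 1)) = 0 := by
    intro i hi
    have h2 := hjump i hi
    have h3 : E (C.A (i + 1)) ≤ 0 := (hEAB (i + 1) hi).trans (hB (m - (i + 1)) (i + 1) (by omega))
    have h4 : 0 ≤ E (C.B i) := (hA i hi.le).trans (hEAB i hi.le)
    have h5 : lam.im ^ 2 * (C.A (i + 1) - C.B i) * Complex.normSq (y (C.A (i + 1))) ≤ 0 := by
      linarith
    have h6 : 0 < lam.im ^ 2 * (C.A (i + 1) - C.B i) := mul_pos hlam2 (sub_pos.2 (C.lt i))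
    by_contra h7
    exact absurd (mul_pos h6 (Complex.normSq_pos.2 h7)) (not_lt.2 h5)
  rcases (C.le i).eq_or_lt with heq | hlt
  · obtain rfl : t = C.A i := le_antisymm (ht.2.trans heq.ge) ht.1
    cases i with
    | succ i => exact hyA i (by omega)
    | zero =>
      rcases h0 with h0 | h0
      · exact h0
      -- No increment of E sees y at an initial isolated point; there z = 0 gives y(A 0) = y(A 1) =
      -- 0.
      · have h2 := h.jumpY 0 (hm.resolve_left heq.not_lt)
        rw [hyA 0 (hm.resolve_left heq.not_lt), ← heq, h0] at h2
        simpa using h2.symm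
  · have hzero : ∀ t ∈ Icc (C.A i) (C.B i), E t = 0 := fun t ht =>
      le_antisymm ((hEmono i hi ht (right_mem_Icc.2 (C.le i)) ht.2).trans
        (hB (m - i) i (by omega)))
        ((hA i hi).trans (hEmono i hi (left_mem_Icc.2 (C.le i)) ht ht.1))
    have hIoo : ∀ t ∈ Ioo (C.A i) (C.B i), y t = 0 := by
      intro t ht
      have h2 : E =ᶠ[𝓝 t] fun _ => 0 := by
        filter_upwards [Icc_mem_nhds ht.1 ht.2] with s hs using hzero s hs
      have h3 := (hEderiv i hi t ht).unique ((hasDerivAt_const t (0 : ℝ)).congr_of_eventuallyEq h2)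
      exact Complex.normSq_eq_zero.1 ((mul_eq_zero.1 h3).resolve_left hlam2.ne')
    have h2 : ContinuousWithinAt y (Ioo (C.A i) (C.B i)) t :=
      (h.contY i hi t ht).mono Ioo_subset_Icc_self
    have h3 := h2.mem_closure (t := {0}) (by rw [closure_Ioo hlt.ne]; exact ht) (fun t ht => hIoo t ht)
    simpa using h3

end IsSol

/-- The transition across a gap in terms of the Prüfer angle. -/
theorem exists_transition (lam u : ℝ) (i : ℕ) : ∃ ρ : ℝ, 0 < ρ ∧
    ρ * Real.sin ((C.gapZ i).flow lam ((C.gapY i).flow lam u)) =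
      Real.sin u + (C.A (i + 1) - C.B i) * Real.cos u ∧
    ρ * Real.cos ((C.gapZ i).flow lam ((C.gapY i).flow lam u)) = Real.cos u +
      (C.A (i + 1) - C.B i) * ((C.q (C.B i) - lam) *
        (Real.sin u + (C.A (i + 1) - C.B i) * Real.cos u)) := by
  obtain ⟨r, hr1, hr, hd⟩ := Piece.exists_radius (P := C.gapY i) lam u
  obtain ⟨r', hr1', hr', hd'⟩ := Piece.exists_radius (P := C.gapZ i) lam ((C.gapY i).flow lam u)
  have hmem : ∀ {P : Piece}, P.b ∈ Icc P.a P.b := fun {P} => right_mem_Icc.2 P.le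
  -- In the first shear r cos is constant and r sin is affine; in the second the roles are
  -- exchanged.
  have hcos : ∀ t ∈ Icc (C.gapY i).a (C.gapY i).b,
      r t * Real.cos ((C.gapY i).angle lam u t) = Real.cos u := by
    intro t ht
    have := eq_add_mul_of_hasDerivWithinAt_const
      (f := fun t => r t * Real.cos ((C.gapY i).angle lam u t)) (c := 0)
      (fun s hs => by simpa [gapY] using (hd s hs).2) ht
    simpa [hr1, Piece.angle_left] using this
  have hsin := eq_add_mul_of_hasDerivWithinAt_const
    (f := fun t => r t * Real.sin ((C.gapY i).angle lam u t)) (c := Real.cos u)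
    (fun s hs => by
      have h := (hd s hs).1
      rw [hcos s hs] at h
      simpa [gapY] using h) (hmem (P := C.gapY i))
  have hsin' : ∀ t ∈ Icc (C.gapZ i).a (C.gapZ i).b,
      r' t * Real.sin ((C.gapZ i).angle lam ((C.gapY i).flow lam u) t)
        = Real.sin ((C.gapY i).flow lam u) := by
    intro t ht
    have := eq_add_mul_of_hasDerivWithinAt_const
      (f := fun t => r' t * Real.sin ((C.gapZ i).angle lam ((C.gapY i).flow lam u) t)) (c := 0)
      (fun s hs => by simpa [gapZ] using (hd' s hs).1) ht
    simpa [hr1', Piece.angle_left] using this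
  have hcos' := eq_add_mul_of_hasDerivWithinAt_const
    (f := fun t => r' t * Real.cos ((C.gapZ i).angle lam ((C.gapY i).flow lam u) t))
    (c := (C.q (C.B i) - lam) * Real.sin ((C.gapY i).flow lam u))
    (fun s hs => by
      have h := (hd' s hs).2
      rw [hsin' s hs] at h
      simpa [gapZ] using h) (hmem (P := C.gapZ i))
  have hcosb := hcos _ hmem
  have hsinb' := hsin' _ hmem
  rw [Piece.angle_left, hr1, one_mul] at hsin
  rw [Piece.angle_left, hr1', one_mul] at hcos'
  change r (C.A (i + 1)) * Real.sin ((C.gapY i).flow lam u)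
    = Real.sin u + Real.cos u * (C.A (i + 1) - C.B i) at hsin
  change r (C.A (i + 1)) * Real.cos ((C.gapY i).flow lam u) = Real.cos u at hcosb
  change r' (C.A (i + 1)) * Real.sin ((C.gapZ i).flow lam ((C.gapY i).flow lam u)) = _ at hsinb'
  change r' (C.A (i + 1)) * Real.cos ((C.gapZ i).flow lam ((C.gapY i).flow lam u))
    = _ + _ * (C.A (i + 1) - C.B i) at hcos'
  refine ⟨r (C.A (i + 1)) * r' (C.A (i + 1)), mul_pos (hr _) (hr' _), ?_, ?_⟩
  · rw [mul_assoc, hsinb', hsin]; ring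
  · rw [mul_assoc, hcos']
    linear_combination hcosb + (C.q (C.B i) - lam) * (C.A (i + 1) - C.B i) * hsin

open Classical in
/-- The index of the component that contains `t`. -/
noncomputable def idx (C : Chain) (t : ℝ) : ℕ := if h : ∃ i, t ≤ C.B i then Nat.find h else 0

theorem idx_eq {t : ℝ} {i : ℕ} (ht : t ∈ Icc (C.A i) (C.B i)) : C.idx t = i := by
  classical
  rw [idx, dif_pos ⟨i, ht.2⟩, Nat.find_eq_iff]
  exact ⟨ht.2, fun j hj => not_le.2 ((Components.B_lt_A hj).trans_le ht.1)⟩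

/-- The solution with the initial values `y = sin x`, `y^Δ = cos x`. -/
theorem exists_isSol (C : Chain) (m : ℕ) (lam x : ℝ) : ∃ y z : ℝ → ℂ, C.IsSol m lam y z ∧
    (∀ i, ∀ t ∈ Icc (C.A i) (C.B i), HasDerivWithinAt y (z t) (Icc (C.A i) (C.B i)) t ∧
      HasDerivWithinAt z ((C.q t - lam) * y t) (Icc (C.A i) (C.B i)) t) ∧
    y (C.A 0) = (Real.sin x : ℝ) ∧ z (C.A 0) = (Real.cos x : ℝ) ∧
    ∃ r : ℝ, 0 < r ∧ y (C.B m) = (r * Real.sin (C.endAngle m lam x) : ℝ) := by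
  choose r hr1 hr hd using fun i => Piece.exists_radius (P := C.seg i) lam (C.angle lam x i)
  choose ρ hρ hρs hρc using fun i => exists_transition (C := C) lam (C.endAngle i lam x) i
  -- The radii on the components all start at 1; R i is the amplitude accumulated up to `A i`.
  let R : ℕ → ℝ := fun n => Nat.rec 1 (fun i s => s * r i (C.B i) * ρ i) n
  have hR0 : R 0 = 1 := rfl
  have hRs : ∀ i, R (i + 1) = R i * r i (C.B i) * ρ i := fun _ => rfl
  have hRpos : ∀ i, 0 < R i := by
    intro i
    induction i with
    | zero => exact one_pos
    | succ i ih => rw [hRs]; exact mul_pos (mul_pos ih (hr _ _)) (hρ _)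
  let Y : ℝ → ℝ := fun t =>
    R (C.idx t) * (r (C.idx t) t * Real.sin ((C.seg (C.idx t)).angle lam (C.angle lam x (C.idx t)) t))
  let Z : ℝ → ℝ := fun t =>
    R (C.idx t) * (r (C.idx t) t * Real.cos ((C.seg (C.idx t)).angle lam (C.angle lam x (C.idx t)) t))
  have hY : ∀ i, ∀ t ∈ Icc (C.A i) (C.B i),
      Y t = R i * (r i t * Real.sin ((C.seg i).angle lam (C.angle lam x i) t)) := fun i t ht => by
    simp only [Y, idx_eq ht]
  have hZ : ∀ i, ∀ t ∈ Icc (C.A i) (C.B i),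
      Z t = R i * (r i t * Real.cos ((C.seg i).angle lam (C.angle lam x i) t)) := fun i t ht => by
    simp only [Z, idx_eq ht]
  have hdY : ∀ i, ∀ t ∈ Icc (C.A i) (C.B i),
      HasDerivWithinAt (fun t => (Y t : ℂ)) (Z t : ℂ) (Icc (C.A i) (C.B i)) t := by
    intro i t ht
    refine HasDerivWithinAt.ofReal_comp ?_
    have h := ((hd i t ht).1.const_mul (R i)).congr (hY i) (hY i t ht)
    rw [hZ i t ht]
    simpa [seg] using h
  have hdZ : ∀ i, ∀ t ∈ Icc (C.A i) (C.B i), HasDerivWithinAt (fun t => (Z t : ℂ))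
      ((C.q t - lam) * (Y t : ℂ)) (Icc (C.A i) (C.B i)) t := by
    intro i t ht
    have h := ((hd i t ht).2.const_mul (R i)).congr (hZ i) (hZ i t ht)
    have h2 : HasDerivWithinAt Z ((C.q t - lam) * Y t) (Icc (C.A i) (C.B i)) t := by
      rw [hY i t ht]
      convert! h using 1
      simp [seg]
      ring
    simpa using h2.ofReal_comp
  have hrA : ∀ i, r i (C.A i) = 1 := hr1
  have hYA : ∀ i, Y (C.A i) = R i * Real.sin (C.angle lam x i) := fun i => by
    rw [hY i _ (left_mem_Icc.2 (C.le i)), hrA, one_mul]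
    exact congrArg (fun s => R i * Real.sin s) (Piece.angle_left _ _ _)
  have hZA : ∀ i, Z (C.A i) = R i * Real.cos (C.angle lam x i) := fun i => by
    rw [hZ i _ (left_mem_Icc.2 (C.le i)), hrA, one_mul]
    exact congrArg (fun s => R i * Real.cos s) (Piece.angle_left _ _ _)
  have hYB : ∀ i, Y (C.B i) = R i * (r i (C.B i) * Real.sin (C.endAngle i lam x)) := fun i =>
    hY i _ (right_mem_Icc.2 (C.le i))
  have hZB : ∀ i, Z (C.B i) = R i * (r i (C.B i) * Real.cos (C.endAngle i lam x)) := fun i =>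
    hZ i _ (right_mem_Icc.2 (C.le i))
  have hjY : ∀ i, Y (C.A (i + 1)) = Y (C.B i) + (C.A (i + 1) - C.B i) * Z (C.B i) := by
    intro i
    have h := hρs i
    change ρ i * Real.sin (C.angle lam x (i + 1)) = _ at h
    rw [hYA, hYB, hZB, hRs]
    linear_combination R i * r i (C.B i) * h
  have hjZ : ∀ i, Z (C.A (i + 1)) =
      Z (C.B i) + (C.A (i + 1) - C.B i) * ((C.q (C.B i) - lam) * Y (C.A (i + 1))) := by
    intro i
    have h := hρc i
    change ρ i * Real.cos (C.angle lam x (i + 1)) = _ at h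
    rw [hjY, hZA, hYB, hZB, hRs]
    linear_combination R i * r i (C.B i) * h
  refine ⟨fun t => Y t, fun t => Z t, ⟨fun i _ t ht => (hdY i t ht).continuousWithinAt,
    fun i _ t ht => (hdZ i t ht).continuousWithinAt,
    fun i _ t ht => hdY i t (Ico_subset_Icc_self ht),
    fun i _ t ht => hdZ i t (Ico_subset_Icc_self ht),
    fun i _ => by rw [hjY]; push_cast; ring, fun i _ => ?_⟩,
    fun i t ht => ⟨hdY i t ht, hdZ i t ht⟩, ?_, ?_, R m * r m (C.B m),
    mul_pos (hRpos m) (hr _ _), ?_⟩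
  · rw [hjZ]; push_cast; ring
  · change ((Y (C.A 0) : ℝ) : ℂ) = _
    rw [hYA, hR0, one_mul, angle]
  · change ((Z (C.A 0) : ℝ) : ℂ) = _
    rw [hZA, hR0, one_mul, angle]
  · change ((Y (C.B m) : ℝ) : ℂ) = _
    rw [hYB]; push_cast; ring

end Chain

/-! ### Δ-derivatives and truncation on a union of components -/

theorem hasDeltaDerivAt_iff_of_fwd_eq {T : Set ℝ} {f : ℝ → ℂ} {d : ℂ} {t : ℝ} (h : fwd T t = t) :
    HasDeltaDerivAt T f d t ↔ HasDerivWithinAt f d T t := by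
  rw [hasDerivWithinAt_iff_isLittleO, Asymptotics.isLittleO_iff]
  unfold HasDeltaDerivAt
  refine forall₂_congr fun ε hε => ?_
  rw [eventually_nhdsWithin_iff, Metric.eventually_nhds_iff]
  refine exists_congr fun δ => and_congr_right fun hδ => ?_
  have hn : ∀ s, ‖f (fwd T t) - f s - d * ((fwd T t - s : ℝ) : ℂ)‖ ≤ ε * |fwd T t - s| ↔
      ‖f s - f t - (s - t) • d‖ ≤ ε * ‖s - t‖ := by
    intro s
    rw [h, Real.norm_eq_abs, abs_sub_comm t s, ← norm_neg]
    have : -(f t - f s - d * ((t - s : ℝ) : ℂ)) = f s - f t - (s - t) • d := by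
      rw [Complex.real_smul]; push_cast; ring
    rw [this]
  constructor
  · intro H s hs hsT
    exact (hn s).1 (H s hsT hs)
  · intro H s hsT hs
    exact (hn s).2 (H hs hsT)

/-- Testing the definition with s = t forces the difference quotient; for the other s it then says
that f(s) - d s is continuous at t, as |σ - s| stays bounded and away from 0. -/
theorem hasDeltaDerivAt_iff_of_lt_fwd {T : Set ℝ} {f : ℝ → ℂ} {d : ℂ} {t : ℝ} (ht : t ∈ T)
    (h : t < fwd T t) : HasDeltaDerivAt T f d t ↔
      f (fwd T t) = f t + ((fwd T t - t : ℝ) : ℂ) * d ∧ ContinuousWithinAt f T t := by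
  set σ := fwd T t
  have hσ : 0 < σ - t := sub_pos.2 h
  have hcont : ContinuousWithinAt (fun s : ℝ => f s - d * (s : ℂ)) T t ↔
      ContinuousWithinAt f T t := by
    have hd : ContinuousWithinAt (fun s : ℝ => d * (s : ℂ)) T t := by fun_prop
    exact ⟨fun H => by simpa [Pi.add_def] using H.add hd, fun H => H.sub hd⟩
  rw [← hcont, Metric.continuousWithinAt_iff]
  have hn : f σ = f t + ((σ - t : ℝ) : ℂ) * d → ∀ s, ‖f σ - f s - d * ((σ - s : ℝ) : ℂ)‖ =
      dist (f s - d * (s : ℂ)) (f t - d * (t : ℂ)) := by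
    intro he s
    rw [dist_comm, dist_eq_norm, he]
    congr 1
    push_cast
    ring
  constructor
  · intro H
    have he : f σ = f t + ((σ - t : ℝ) : ℂ) * d := by
      have h0 : ‖f σ - f t - d * ((σ - t : ℝ) : ℂ)‖ ≤ 0 := by
        refine le_of_forall_pos_le_add fun ε hε => ?_
        obtain ⟨δ, hδ, hH⟩ := H (ε / (σ - t)) (div_pos hε hσ)
        have := hH t ht (by simpa using hδ)
        rw [abs_of_pos hσ, div_mul_cancel₀ _ hσ.ne'] at this
        simpa using this
      have h1 := norm_le_zero_iff.1 h0
      linear_combination h1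
    refine ⟨he, fun η hη => ?_⟩
    obtain ⟨δ, hδ, hH⟩ := H (η / (2 * (σ - t + 1))) (by positivity)
    refine ⟨min δ 1, by positivity, fun s hs hst => ?_⟩
    rw [← hn he]
    rw [Real.dist_eq] at hst
    have h1 : |s - t| < 1 := hst.trans_le (min_le_right _ _)
    have h2 : |σ - s| ≤ σ - t + 1 := by
      have : σ - s = (σ - t) - (s - t) := by ring
      rw [this]
      refine (abs_sub _ _).trans ?_
      rw [abs_of_pos hσ]
      linarith
    calc _ ≤ η / (2 * (σ - t + 1)) * |σ - s| := hH s hs (hst.trans_le (min_le_left _ _))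
      _ ≤ η / (2 * (σ - t + 1)) * (σ - t + 1) := by gcongr
      _ = η / 2 := by field_simp
      _ < η := by linarith
  · rintro ⟨he, H⟩ ε hε
    obtain ⟨δ, hδ, hH⟩ := H (ε * ((σ - t) / 2)) (by positivity)
    refine ⟨min δ ((σ - t) / 2), by positivity, fun s hs hst => ?_⟩
    rw [hn he]
    refine (hH hs (by rw [Real.dist_eq]; exact hst.trans_le (min_le_left _ _))).le.trans ?_
    gcongr
    have h1 := (abs_lt.1 (hst.trans_le (min_le_right _ _))).2
    exact le_trans (by linarith) (le_abs_self _)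

namespace Components

variable (K : Components)

/-- The union of the components with indices `0, …, m`. -/
def set (m : ℕ) : Set ℝ := {x | ∃ i ≤ m, x ∈ Icc (K.A i) (K.B i)}

variable {K} {m i : ℕ} {t : ℝ}

theorem mem_set (hi : i ≤ m) (ht : t ∈ Icc (K.A i) (K.B i)) : t ∈ K.set m := ⟨i, hi, ht⟩

theorem A_mem (i : ℕ) : K.A i ∈ Icc (K.A i) (K.B i) := left_mem_Icc.2 (K.le i)

theorem B_mem (i : ℕ) : K.B i ∈ Icc (K.A i) (K.B i) := right_mem_Icc.2 (K.le i)

theorem eq_of_mem_Icc {j : ℕ} (hi : t ∈ Icc (K.A i) (K.B i)) (hj : t ∈ Icc (K.A j) (K.B j)) :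
    i = j := by
  rcases lt_trichotomy i j with h | h | h
  · exact absurd (hi.2.trans_lt (B_lt_A h)) (not_lt.2 hj.1)
  · exact h
  · exact absurd (hj.2.trans_lt (B_lt_A h)) (not_lt.2 hi.1)

theorem nhdsWithin_set (hi : i ≤ m) (ht : t ∈ Icc (K.A i) (K.B i)) :
    𝓝[K.set m] t = 𝓝[Icc (K.A i) (K.B i)] t := by
  obtain ⟨u, hu, huj⟩ : ∃ u < K.A i, ∀ j < i, K.B j ≤ u := by
    cases i with
    | zero => exact ⟨K.A 0 - 1, by linarith, fun j hj => absurd hj (Nat.not_lt_zero j)⟩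
    | succ i => exact ⟨K.B i, K.lt i, fun j hj => strictMono_B.monotone (by omega)⟩
  refine nhdsWithin_eq_nhdsWithin (s := Ioo u (K.A (i + 1)))
    ⟨hu.trans_le ht.1, ht.2.trans_lt (K.lt i)⟩ isOpen_Ioo ?_
  ext s
  constructor
  · rintro ⟨⟨j, hj, hs⟩, hs'⟩
    refine ⟨?_, hs'⟩
    rcases lt_trichotomy i j with h | rfl | h
    · exfalso
      have h1 : K.A (i + 1) ≤ K.A j := by
        rcases (Nat.succ_le_of_lt h).eq_or_lt with rfl | h2
        · exact le_rfl
        · exact (K.le _).trans (B_lt_A h2).le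
      linarith [hs.1, hs'.2]
    · exact hs
    · linarith [hs.2, hs'.1, huj j h]
  · rintro ⟨hs, hs'⟩
    exact ⟨⟨i, hi, hs⟩, hs'⟩

theorem isLeast_set (m : ℕ) : IsLeast (K.set m) (K.A 0) := by
  refine ⟨mem_set (Nat.zero_le m) (A_mem 0), ?_⟩
  rintro s ⟨j, _, hs⟩
  rcases Nat.eq_zero_or_pos j with rfl | hj
  · exact hs.1
  · exact ((K.le 0).trans (B_lt_A hj).le).trans hs.1

theorem isGreatest_set (m : ℕ) : IsGreatest (K.set m) (K.B m) := by
  refine ⟨mem_set le_rfl (B_mem m), ?_⟩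
  rintro s ⟨j, hj, hs⟩
  exact hs.2.trans (strictMono_B.monotone hj)

theorem fwd_of_mem_Ico (hi : i ≤ m) (ht : t ∈ Ico (K.A i) (K.B i)) : fwd (K.set m) t = t := by
  have hmem : ∀ s ∈ Ioc t (K.B i), s ∈ K.set m := fun s hs =>
    mem_set hi ⟨ht.1.trans hs.1.le, hs.2⟩
  rw [fwd, if_pos ⟨K.B i, hmem _ ⟨ht.2, le_rfl⟩, ht.2⟩]
  refine csInf_eq_of_forall_ge_of_forall_gt_exists_lt
    ⟨K.B i, hmem _ ⟨ht.2, le_rfl⟩, ht.2⟩ (fun s hs => hs.2.le) fun w hw => ?_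
  obtain ⟨s, hs1, hs2⟩ := exists_between (lt_min hw ht.2)
  exact ⟨s, ⟨hmem s ⟨hs1, (hs2.trans_le (min_le_right _ _)).le⟩, hs1⟩,
    hs2.trans_le (min_le_left _ _)⟩

theorem fwd_B (hi : i < m) : fwd (K.set m) (K.B i) = K.A (i + 1) := by
  have hmem : K.A (i + 1) ∈ K.set m := mem_set (Nat.succ_le_of_lt hi) (A_mem _)
  rw [fwd, if_pos ⟨_, hmem, K.lt i⟩]
  refine IsLeast.csInf_eq ⟨⟨hmem, K.lt i⟩, ?_⟩
  rintro s ⟨⟨j, hj, hs⟩, hs'⟩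
  rcases lt_trichotomy (i + 1) j with h | rfl | h
  · exact ((K.le _).trans (B_lt_A h).le).trans hs.1
  · exact hs.1
  · exact absurd (hs.2.trans (strictMono_B.monotone (Nat.lt_succ_iff.1 h))) (not_le.2 hs')

theorem fwd_B_last (m : ℕ) : fwd (K.set m) (K.B m) = K.B m := by
  rw [fwd, if_neg]
  rintro ⟨s, hs, hs'⟩
  exact absurd ((isGreatest_set m).2 hs) (not_le.2 hs')

theorem trunc_of_lt (h : K.A m < K.B m) : trunc (K.set m) = K.set m := by
  refine Subset.antisymm (fun x hx => hx.1) fun x hx => ⟨hx, fun hx' => ?_⟩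
  obtain rfl := hx'.1.unique (isGreatest_set m)
  have hmem : ∀ s ∈ Ico (K.A m) (K.B m), s ∈ K.set m := fun s hs =>
    mem_set le_rfl ⟨hs.1, hs.2.le⟩
  have hbwd : bwd (K.set m) (K.B m) = K.B m := by
    rw [bwd, if_pos ⟨K.A m, hmem _ ⟨le_rfl, h⟩, h⟩]
    refine csSup_eq_of_forall_le_of_forall_lt_exists_gt
      ⟨K.A m, hmem _ ⟨le_rfl, h⟩, h⟩ (fun s hs => hs.2.le) fun w hw => ?_
    obtain ⟨s, hs1, hs2⟩ := exists_between (max_lt hw h)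
    exact ⟨s, ⟨hmem s ⟨((le_max_right _ _).trans_lt hs1).le, hs2⟩, hs2⟩,
      (le_max_left _ _).trans_lt hs1⟩
  exact absurd hx'.2 (by rw [hbwd]; exact lt_irrefl _)

theorem trunc_of_eq_zero (h : K.A 0 = K.B 0) : trunc (K.set 0) = K.set 0 := by
  refine Subset.antisymm (fun x hx => hx.1) fun x hx => ⟨hx, fun hx' => ?_⟩
  have hnone : ¬ ∃ s ∈ K.set 0, s < x := by
    rintro ⟨s, hs, hs'⟩
    have h1 := (isLeast_set 0).2 hs
    have h2 := (isGreatest_set 0).2 hx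
    linarith
  have h3 := hx'.2
  rw [bwd, if_neg hnone] at h3
  exact lt_irrefl _ h3

theorem trunc_of_eq (h : K.A (m + 1) = K.B (m + 1)) : trunc (K.set (m + 1)) = K.set m := by
  refine Subset.antisymm ?_ ?_
  · rintro x ⟨⟨j, hj, hx⟩, hx'⟩
    rcases hj.eq_or_lt with rfl | hj
    · exfalso
      obtain rfl : x = K.B (m + 1) := le_antisymm hx.2 (h.symm.trans_le hx.1)
      refine hx' ⟨isGreatest_set _, ?_⟩
      have hmem : K.B m ∈ K.set (m + 1) := mem_set (Nat.le_succ m) (B_mem m)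
      have hlt : K.B m < K.B (m + 1) := strictMono_B (Nat.lt_succ_self m)
      rw [bwd, if_pos ⟨_, hmem, hlt⟩]
      refine lt_of_le_of_lt (csSup_le ⟨_, hmem, hlt⟩ ?_) hlt
      rintro s ⟨⟨k, hk, hs⟩, hs'⟩
      rcases hk.eq_or_lt with rfl | hk
      · exact absurd (h.symm.trans_le hs.1) (not_le.2 hs')
      · exact hs.2.trans (strictMono_B.monotone (by omega))
    · exact mem_set (by omega) hx
  · rintro x ⟨j, hj, hx⟩
    refine ⟨mem_set (by omega) hx, fun hx' => ?_⟩
    have h1 := hx'.1.unique (isGreatest_set _)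
    have h2 : K.B j < K.B (m + 1) := strictMono_B (by omega)
    linarith [hx.2]

/-- Truncation removes the last component if this is a point but not the only component. -/
theorem exists_trunc_eq (K : Components) (m : ℕ) : ∃ m', trunc (K.set m) = K.set m' ∧ m' ≤ m ∧
    m ≤ m' + 1 ∧ (m' < m → K.A m = K.B m) := by
  rcases (K.le m).lt_or_eq with h | h
  · exact ⟨m, trunc_of_lt h, le_rfl, Nat.le_succ m, fun h' => absurd h' (lt_irrefl _)⟩
  · cases m with
    | zero => exact ⟨0, trunc_of_eq_zero h, le_rfl, Nat.zero_le _, fun h' => absurd h' (lt_irrefl _)⟩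
    | succ m => exact ⟨m, trunc_of_eq h, Nat.le_succ m, le_rfl, fun _ => h⟩

variable {f : ℝ → ℂ} {d : ℂ}

theorem hasDerivWithinAt_set_iff (hi : i ≤ m) (ht : t ∈ Icc (K.A i) (K.B i)) :
    HasDerivWithinAt f d (K.set m) t ↔ HasDerivWithinAt f d (Icc (K.A i) (K.B i)) t := by
  rw [HasDerivWithinAt, HasDerivWithinAt, nhdsWithin_set hi ht]

theorem hasDeltaDerivAt_iff_of_mem_Ico (hi : i ≤ m) (ht : t ∈ Ico (K.A i) (K.B i)) :
    HasDeltaDerivAt (K.set m) f d t ↔ HasDerivWithinAt f d (Icc (K.A i) (K.B i)) t := by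
  rw [hasDeltaDerivAt_iff_of_fwd_eq (fwd_of_mem_Ico hi ht),
    hasDerivWithinAt_set_iff hi (Ico_subset_Icc_self ht)]

theorem hasDeltaDerivAt_B_iff (hi : i < m) : HasDeltaDerivAt (K.set m) f d (K.B i) ↔
    f (K.A (i + 1)) = f (K.B i) + ((K.A (i + 1) - K.B i : ℝ) : ℂ) * d ∧
      ContinuousWithinAt f (Icc (K.A i) (K.B i)) (K.B i) := by
  rw [hasDeltaDerivAt_iff_of_lt_fwd (mem_set hi.le (B_mem i)) (by rw [fwd_B hi]; exact K.lt i),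
    fwd_B hi, ContinuousWithinAt, ContinuousWithinAt, nhdsWithin_set hi.le (B_mem i)]

theorem continuousWithinAt_of_hasDeltaDerivAt (hi : i ≤ m) (ht : t ∈ Icc (K.A i) (K.B i))
    (h : HasDeltaDerivAt (K.set m) f d t) : ContinuousWithinAt f (Icc (K.A i) (K.B i)) t := by
  rcases ht.2.lt_or_eq with hlt | rfl
  · exact ((hasDeltaDerivAt_iff_of_mem_Ico hi ⟨ht.1, hlt⟩).1 h).continuousWithinAt
  · rcases hi.lt_or_eq with hlt | rfl
    · exact ((hasDeltaDerivAt_B_iff hlt).1 h).2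
    · rw [hasDeltaDerivAt_iff_of_fwd_eq (fwd_B_last _), hasDerivWithinAt_set_iff hi ht] at h
      exact h.continuousWithinAt

/-- Two values are needed because at a right-scattered end of a segment the Δ-derivative comes from
the jump and may differ from the one-sided derivative. -/
theorem hasDeltaDerivAt_of_hasDerivWithinAt {d' : ℂ} (hi : i ≤ m)
    (ht : t ∈ Icc (K.A i) (K.B i)) (h : HasDerivWithinAt f d' (Icc (K.A i) (K.B i)) t)
    (hd : t < K.B i ∨ i = m → d = d')
    (hjump : t = K.B i → i < m → f (K.A (i + 1)) = f (K.B i) + ((K.A (i + 1) - K.B i : ℝ) : ℂ) * d) :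
    HasDeltaDerivAt (K.set m) f d t := by
  rcases ht.2.lt_or_eq with hlt | rfl
  · rw [hasDeltaDerivAt_iff_of_mem_Ico hi ⟨ht.1, hlt⟩, hd (Or.inl hlt)]
    exact h
  · rcases hi.lt_or_eq with hlt | rfl
    · exact (hasDeltaDerivAt_B_iff hlt).2 ⟨hjump rfl hlt, h.continuousWithinAt⟩
    · rw [hasDeltaDerivAt_iff_of_fwd_eq (fwd_B_last _), hasDerivWithinAt_set_iff hi ht,
        hd (Or.inr rfl)]
      exact h

/-- On a one-point set every number is a Δ-derivative, hence `hm`. -/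
theorem hasDeltaDerivAt_A_zero_unique {d' : ℂ} (hm : K.A 0 < K.B 0 ∨ 0 < m)
    (h : HasDeltaDerivAt (K.set m) f d (K.A 0)) (h' : HasDeltaDerivAt (K.set m) f d' (K.A 0)) :
    d = d' := by
  rcases (K.le 0).lt_or_eq with hlt | heq
  · rw [hasDeltaDerivAt_iff_of_mem_Ico (Nat.zero_le m) ⟨le_rfl, hlt⟩] at h h'
    exact (uniqueDiffOn_Icc hlt _ (A_mem 0)).eq_deriv _ h h'
  · have hm : 0 < m := hm.resolve_left (by rw [heq]; exact lt_irrefl _)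
    rw [heq, hasDeltaDerivAt_B_iff hm] at h h'
    have h0 : ((K.A (0 + 1) - K.B 0 : ℝ) : ℂ) ≠ 0 := by
      exact_mod_cast (sub_pos.2 (K.lt 0)).ne'
    exact mul_left_cancel₀ h0 (add_left_cancel (h.1.symm.trans h'.1))

theorem mem_set_iff_le (ht : t ∈ Icc (K.A i) (K.B i)) : t ∈ K.set m ↔ i ≤ m := by
  refine ⟨?_, fun h => mem_set h ht⟩
  rintro ⟨j, hj, hs⟩
  rwa [eq_of_mem_Icc ht hs]

end Components

/-! ### The time-scale equation as the system; spectra through end angles -/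

namespace Chain

open Components

variable {C : Chain} {m : ℕ} {lam : ℂ} {y : ℝ → ℂ}

theorem exists_isSol_of_isSolution (h : IsSolution (C.set m) C.q lam y) :
    ∃ z : ℝ → ℂ, C.IsSol m lam y z ∧ (C.A 0 < C.B 0 ∨ 0 < m →
      HasDeltaDerivAt (C.set m) y (z (C.A 0)) (C.A 0)) := by
  classical
  obtain ⟨y₁, y₂, h1, h2, -, heq⟩ := h
  obtain ⟨m₁, e₁, hle₁, hge₁, hlt₁⟩ := exists_trunc_eq C.toComponents m
  rw [e₁] at h1 h2 heq
  obtain ⟨m₂, e₂, hle₂, hge₂, hlt₂⟩ := exists_trunc_eq C.toComponents m₁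
  rw [e₂] at h2 heq
  -- Truncation discards only points, so the segments survive both truncations.
  have hnd₁ : ∀ i ≤ m, C.A i < C.B i → i ≤ m₁ := by
    intro i hi hlt
    by_contra hc
    obtain rfl : i = m := by omega
    exact hlt.ne (hlt₁ (by omega))
  have hnd₂ : ∀ i ≤ m, C.A i < C.B i → i ≤ m₂ := by
    intro i hi hlt
    have := hnd₁ i hi hlt
    by_contra hc
    obtain rfl : i = m₁ := by omega
    exact hlt.ne (hlt₂ (by omega))
  have hsub : ∀ i, ¬ C.A i < C.B i → ∀ f : ℝ → ℂ, ContinuousOn f (Icc (C.A i) (C.B i)) := by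
    intro i hi f
    exact (Set.subsingleton_Icc_of_ge (not_lt.1 hi)).continuousOn f
  -- At an isolated maximum y^Δ is undefined; the missing jump relation serves as the definition of
  -- z there.
  set z : ℝ → ℂ := fun t => if t ∈ C.set m₁ then y₁ t else
    y₁ (C.B m₁) + ((C.A (m₁ + 1) - C.B m₁ : ℝ) : ℂ) * ((C.q (C.B m₁) - lam) * y (C.A (m₁ + 1)))
    with hz
  have hzy : ∀ i ≤ m₁, ∀ t ∈ Icc (C.A i) (C.B i), z t = y₁ t := fun i hi t ht => by
    simp only [hz, if_pos (mem_set hi ht)]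
  refine ⟨z, ⟨?_, ?_, ?_, ?_, ?_, ?_⟩, fun hm => ?_⟩
  · intro i hi
    by_cases hlt : C.A i < C.B i
    · exact fun t ht => continuousWithinAt_of_hasDeltaDerivAt hi ht
        (h1 t (mem_set (hnd₁ i hi hlt) ht))
    · exact hsub i hlt y
  · intro i hi
    by_cases hlt : C.A i < C.B i
    · refine ContinuousOn.congr (fun t ht => ?_) (hzy i (hnd₁ i hi hlt))
      exact continuousWithinAt_of_hasDeltaDerivAt (hnd₁ i hi hlt) ht
        (h2 t (mem_set (hnd₂ i hi hlt) ht))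
    · exact hsub i hlt z
  · intro i hi t ht
    have hi₁ := hnd₁ i hi (ht.1.trans_lt ht.2)
    rw [hzy i hi₁ t (Ico_subset_Icc_self ht)]
    exact (hasDeltaDerivAt_iff_of_mem_Ico hi ht).1 (h1 t (mem_set hi₁ (Ico_subset_Icc_self ht)))
  · intro i hi t ht
    have ht' := Ico_subset_Icc_self ht
    have hi₁ := hnd₁ i hi (ht.1.trans_lt ht.2)
    have hi₂ := hnd₂ i hi (ht.1.trans_lt ht.2)
    have h3 := (hasDeltaDerivAt_iff_of_mem_Ico hi₁ ht).1 (h2 t (mem_set hi₂ ht'))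
    have h4 := heq t (mem_set hi₂ ht') (by rw [fwd_of_mem_Ico hi ht]; exact mem_set hi₁ ht')
    rw [fwd_of_mem_Ico hi ht] at h4
    have h5 : y₂ t = (C.q t - lam) * y t := by linear_combination -h4
    rw [← h5]
    exact h3.congr (hzy i hi₁) (hzy i hi₁ t ht')
  · intro i hi
    rw [hzy i (by omega) _ (B_mem i)]
    exact ((hasDeltaDerivAt_B_iff hi).1 (h1 _ (mem_set (by omega) (B_mem i)))).1
  · intro i hi
    rw [hzy i (by omega) _ (B_mem i)]
    rcases Nat.lt_or_ge i m₁ with hi₁ | hi₁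
    · rw [hzy (i + 1) hi₁ _ (A_mem _)]
      have h3 := ((hasDeltaDerivAt_B_iff hi₁).1 (h2 _ (mem_set (by omega) (B_mem i)))).1
      have h4 := heq (C.B i) (mem_set (by omega) (B_mem i))
        (by rw [fwd_B hi]; exact mem_set hi₁ (A_mem _))
      rw [fwd_B hi] at h4
      rw [h3]
      linear_combination (-((C.A (i + 1) - C.B i : ℝ) : ℂ)) * h4
    · obtain rfl : i = m₁ := by omega
      have : C.A (i + 1) ∉ C.set i := by
        rw [mem_set_iff_le (A_mem (i + 1))]
        omega
      simp only [hz, if_neg this]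
  · rw [hzy 0 (Nat.zero_le _) _ (A_mem 0)]
    exact h1 _ (mem_set (Nat.zero_le _) (A_mem 0))

theorem IsSol.isSolution {z : ℝ → ℂ} (h : C.IsSol m lam y z)
    (hd : ∀ i, ∀ t ∈ Icc (C.A i) (C.B i), HasDerivWithinAt y (z t) (Icc (C.A i) (C.B i)) t ∧
      HasDerivWithinAt z ((C.q t - lam) * y t) (Icc (C.A i) (C.B i)) t) :
    IsSolution (C.set m) C.q lam y ∧ HasDeltaDerivAt (C.set m) y (z (C.A 0)) (C.A 0) := by
  obtain ⟨m₁, e₁, hle₁, hge₁, -⟩ := exists_trunc_eq C.toComponents m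
  obtain ⟨m₂, e₂, hle₂, hge₂, -⟩ := exists_trunc_eq C.toComponents m₁
  have hY : ∀ i ≤ m, ∀ t ∈ Icc (C.A i) (C.B i), HasDeltaDerivAt (C.set m) y (z t) t :=
    fun i hi t ht => hasDeltaDerivAt_of_hasDerivWithinAt hi ht (hd i t ht).1 (fun _ => rfl)
      (fun he hlt => by rw [he]; exact h.jumpY i hlt)
  -- The jump function is that of T⁰: if T⁰ ends in a segment, y^ΔΔ at its right end is a one-sided
  -- derivative, even when T has one more point and the equation is not required there.
  refine ⟨⟨z, fun x => (C.q x - lam) * y (fwd (C.set m₁) x), ?_, ?_, ⟨?_, ?_⟩, ?_⟩,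
    hY 0 (Nat.zero_le m) _ (A_mem 0)⟩
  all_goals simp only [e₁, e₂]
  · rintro t ⟨i, hi, ht⟩
    exact hY i (hi.trans hle₁) t ht
  · rintro t ⟨i, hi, ht⟩
    refine hasDeltaDerivAt_of_hasDerivWithinAt (hi.trans hle₂) ht (hd i t ht).2 ?_ ?_
    · rintro (hlt | rfl)
      · rw [fwd_of_mem_Ico (hi.trans hle₂) ⟨ht.1, hlt⟩]
      · rcases ht.2.lt_or_eq with hlt | rfl
        · rw [fwd_of_mem_Ico (hi.trans hle₂) ⟨ht.1, hlt⟩]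
        · rw [fwd_B_last]
    · rintro rfl hlt
      rw [fwd_B hlt]
      exact h.jumpZ i (by omega)
  · rintro t ⟨i, hi, ht⟩ hfwd
    rw [ContinuousWithinAt, nhdsWithin_set hi ht]
    have hc : ContinuousWithinAt (fun x => (C.q x - lam) * y x) (Icc (C.A i) (C.B i)) t :=
      (((Complex.continuous_ofReal.comp_continuousOn (C.cont i)).sub continuousOn_const).mul
        (h.contY i (by omega))) t ht
    suffices he : (fun x => (C.q x - lam) * y (fwd (C.set m₁) x)) =ᶠ[𝓝[Icc (C.A i) (C.B i)] t]
        fun x => (C.q x - lam) * y x from hc.congr_of_eventuallyEq he (he.self_of_nhdsWithin ht)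
    rcases ht.2.lt_or_eq with hlt | rfl
    · filter_upwards [self_mem_nhdsWithin, nhdsWithin_le_nhds (gt_mem_nhds hlt)] with s hs hs'
      rw [fwd_of_mem_Ico (hi.trans hle₂) ⟨hs.1, hs'⟩]
    · obtain rfl : i = m := by
        by_contra hne
        rw [fwd_B (by omega)] at hfwd
        exact (C.lt i).ne' hfwd
      obtain rfl : i = m₁ := by omega
      filter_upwards [self_mem_nhdsWithin] with s hs
      rcases hs.2.lt_or_eq with hlt | rfl
      · rw [fwd_of_mem_Ico le_rfl ⟨hs.1, hlt⟩]
      · rw [fwd_B_last]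
  · rintro t ⟨i, hi, ht⟩ -
    refine ⟨(C.q t - lam) * y t, ?_⟩
    have hc : ContinuousWithinAt (fun x => (C.q x - lam) * y x) (Icc (C.A i) (C.B i)) t :=
      (((Complex.continuous_ofReal.comp_continuousOn (C.cont i)).sub continuousOn_const).mul
        (h.contY i (by omega))) t ht
    rw [nhdsWithin_inter, nhdsWithin_set hi ht, ← nhdsWithin_inter]
    refine (hc.mono inter_subset_left).tendsto.congr' ?_
    filter_upwards [self_mem_nhdsWithin] with s hs
    rw [fwd_of_mem_Ico (hi.trans hle₂) ⟨hs.1.1, (mem_Iio.1 hs.2).trans_le ht.2⟩]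
  · rintro x ⟨i, hi, hx⟩ hfwd
    have he : fwd (C.set m₁) x = fwd (C.set m) x := by
      rcases hx.2.lt_or_eq with hlt | rfl
      · rw [fwd_of_mem_Ico (hi.trans hle₂) ⟨hx.1, hlt⟩, fwd_of_mem_Ico (by omega) ⟨hx.1, hlt⟩]
      · rcases Nat.lt_or_ge i m with hlt | hge
        · rw [fwd_B hlt, mem_set_iff_le (A_mem (i + 1))] at hfwd
          rw [fwd_B hlt, fwd_B hfwd]
        · obtain rfl : i = m := by omega
          obtain rfl : i = m₁ := by omega
          rfl
    rw [he]
    ring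

/-- By uniqueness y is c times the solution built from the Prüfer angle, and c ≠ 0 because y does
not vanish identically. -/
theorem sin_endAngle_eq_zero {z : ℝ → ℂ} {lam x : ℝ} (h : C.IsSol m lam y z) {c : ℂ}
    (hy : y (C.A 0) = c * (Real.sin x : ℝ)) (hz : z (C.A 0) = c * (Real.cos x : ℝ))
    (h1 : y (C.B m) = 0) (hne : ∃ t ∈ C.set m, y t ≠ 0) :
    Real.sin (C.endAngle m lam x) = 0 := by
  obtain ⟨Y, Z, hsol, -, hY, hZ, r, hr, hB⟩ := C.exists_isSol m lam x
  have hzero := (h.sub_const_mul hsol c).eq_zero (by simp [hy, hY]) (by simp [hz, hZ])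
  have hc : c ≠ 0 := by
    rintro rfl
    obtain ⟨t, ⟨i, hi, ht⟩, hyt⟩ := hne
    exact hyt (by simpa using (hzero i hi t ht).1)
  have h2 := (hzero m le_rfl (C.B m) (B_mem m)).1
  rw [h1, hB, zero_sub, neg_eq_zero] at h2
  have h3 := (mul_eq_zero.1 h2).resolve_left hc
  exact (mul_eq_zero.1 (Complex.ofReal_eq_zero.1 h3)).resolve_left hr.ne'

theorem mem_spectrumL0_iff (hm : C.A 0 < C.B 0 ∨ 0 < m) (lam : ℂ) :
    lam ∈ spectrumL0 (C.set m) C.q ↔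
      ∃ x : ℝ, Real.sin (C.endAngle m x 0) = 0 ∧ (x : ℂ) = lam := by
  have hinf : sInf (C.set m) = C.A 0 := (isLeast_set m).csInf_eq
  have hsup : sSup (C.set m) = C.B m := (isGreatest_set m).csSup_eq
  constructor
  · rintro ⟨y, hy, hne, h0, h1⟩
    rw [hinf] at h0
    rw [hsup] at h1
    obtain ⟨z, hz, -⟩ := exists_isSol_of_isSolution hy
    have him := hz.im_eq_zero hm (Or.inl h0) h1 (by
      obtain ⟨t, ⟨i, hi, ht⟩, hyt⟩ := hne
      exact ⟨i, hi, t, ht, hyt⟩)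
    obtain ⟨x, rfl⟩ : ∃ x : ℝ, (x : ℂ) = lam := ⟨lam.re, Complex.ext rfl him.symm⟩
    exact ⟨x, sin_endAngle_eq_zero hz (c := z (C.A 0)) (by simp [h0]) (by simp) h1 hne, rfl⟩
  · rintro ⟨x, hx, rfl⟩
    obtain ⟨y, z, hsol, hd, hY, hZ, r, hr, hB⟩ := C.exists_isSol m x 0
    refine ⟨y, (hsol.isSolution hd).1, ?_, by rw [hinf, hY]; simp, by rw [hsup, hB, hx]; simp⟩
    -- The solution has y = 0 and y^Δ = 1 at min T, so y ≡ 0 would contradict the derivative on a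
    -- first segment or the jump from a first point.
    by_contra! hzero
    rcases (C.le 0).lt_or_eq with hlt | heq
    · have h1 := (hd 0 _ (A_mem 0)).1
      have h2 : HasDerivWithinAt y 0 (Icc (C.A 0) (C.B 0)) (C.A 0) :=
        (hasDerivWithinAt_const (C.A 0) _ (0 : ℂ)).congr
          (fun t ht => hzero t (mem_set (Nat.zero_le m) ht))
          (hzero _ (mem_set (Nat.zero_le m) (A_mem 0)))
      have h3 := (uniqueDiffOn_Icc hlt _ (A_mem 0)).eq_deriv _ h1 h2
      rw [hZ] at h3
      simp at h3
    · have hm' : 0 < m := hm.resolve_left heq.not_lt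
      have h1 := hsol.jumpY 0 hm'
      rw [hzero _ (mem_set hm' (A_mem 1)), ← heq, hY, hZ] at h1
      have h2 : C.A 1 - C.A 0 ≠ 0 := by
        rw [heq]; exact (sub_pos.2 (C.lt 0)).ne'
      have h3 : ((C.A 1 - C.A 0 : ℝ) : ℂ) = 0 := by simpa using h1.symm
      exact h2 (Complex.ofReal_eq_zero.1 h3)

theorem mem_spectrumL1_iff (hm : C.A 0 < C.B 0 ∨ 0 < m) (lam : ℂ) :
    lam ∈ spectrumL1 (C.set m) C.q ↔
      ∃ x : ℝ, Real.sin (C.endAngle m x (Real.pi / 2)) = 0 ∧ (x : ℂ) = lam := by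
  have hinf : sInf (C.set m) = C.A 0 := (isLeast_set m).csInf_eq
  have hsup : sSup (C.set m) = C.B m := (isGreatest_set m).csSup_eq
  constructor
  · rintro ⟨y, hy, hne, h0, h1⟩
    rw [hinf] at h0
    rw [hsup] at h1
    obtain ⟨z, hz, hzA⟩ := exists_isSol_of_isSolution hy
    have hz0 : z (C.A 0) = 0 := hasDeltaDerivAt_A_zero_unique hm (hzA hm) h0
    have him := hz.im_eq_zero hm (Or.inr hz0) h1 (by
      obtain ⟨t, ⟨i, hi, ht⟩, hyt⟩ := hne
      exact ⟨i, hi, t, ht, hyt⟩)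
    obtain ⟨x, rfl⟩ : ∃ x : ℝ, (x : ℂ) = lam := ⟨lam.re, Complex.ext rfl him.symm⟩
    exact ⟨x, sin_endAngle_eq_zero hz (c := y (C.A 0)) (by simp) (by simp [hz0]) h1 hne, rfl⟩
  · rintro ⟨x, hx, rfl⟩
    obtain ⟨y, z, hsol, hd, hY, hZ, r, hr, hB⟩ := C.exists_isSol m x (Real.pi / 2)
    have hs := hsol.isSolution hd
    refine ⟨y, hs.1, ⟨C.A 0, mem_set (Nat.zero_le m) (A_mem 0), by rw [hY]; simp⟩, ?_,
      by rw [hsup, hB, hx]; simp⟩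
    have h2 := hs.2
    rw [hZ] at h2
    rw [hinf]
    simpa using h2

end Chain

/-! ### Enumeration and interlacing -/

/-- The index type allows one argument for ℕ and for `Fin (M - 2)`. The shift e i + 1 is due to Θ >
0: the first multiple available is π. -/
theorem exists_enumeration {ι : Type*} [LinearOrder ι] {e : ι → ℕ} (he : StrictMono e)
    {Θ : ℝ → ℝ} (hc : Continuous Θ) (hmono : StrictMono Θ) (hpos : ∀ x, 0 < Θ x)
    (hlt : ∃ x, Θ x ≤ Real.pi / 2) (hge : ∀ i, ∃ x, ((e i + 1 : ℕ) : ℝ) * Real.pi ≤ Θ x)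
    (hsurj : ∀ x, ∀ k : ℕ, Θ x = ((k + 1 : ℕ) : ℝ) * Real.pi → ∃ i, e i = k) :
    ∃ lam : ι → ℝ, (∀ i, Θ (lam i) = ((e i + 1 : ℕ) : ℝ) * Real.pi) ∧ StrictMono lam ∧
      ∀ x, Real.sin (Θ x) = 0 ↔ ∃ i, lam i = x := by
  have hpi := Real.pi_pos
  have hex : ∀ i, ∃ x, Θ x = ((e i + 1 : ℕ) : ℝ) * Real.pi := by
    intro i
    obtain ⟨x, hx⟩ := hlt
    obtain ⟨x', hx'⟩ := hge i
    refine mem_range_of_exists_le_of_exists_ge hc ⟨x, hx.trans ?_⟩ ⟨x', hx'⟩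
    have : (1 : ℝ) ≤ ((e i + 1 : ℕ) : ℝ) := by exact_mod_cast Nat.le_add_left 1 (e i)
    nlinarith
  choose lam hlam using hex
  refine ⟨lam, hlam, fun i j hij => hmono.lt_iff_lt.1 ?_, fun x => ⟨fun hx => ?_, ?_⟩⟩
  · rw [hlam, hlam]
    have := he hij
    gcongr
  · obtain ⟨n, hn⟩ := Real.sin_eq_zero_iff.1 hx
    have hn0 : 0 < n := by
      have h := hpos x
      rw [← hn] at h
      exact_mod_cast pos_of_mul_pos_left h hpi.le
    obtain ⟨k, hk⟩ : ∃ k : ℕ, n = ((k + 1 : ℕ) : ℤ) := ⟨(n - 1).toNat, by omega⟩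
    have hk' : Θ x = ((k + 1 : ℕ) : ℝ) * Real.pi := by rw [← hn, hk]; norm_cast
    obtain ⟨i, hi⟩ := hsurj x k hk'
    exact ⟨i, hmono.injective (by rw [hlam, hk', hi])⟩
  · rintro ⟨i, rfl⟩
    rw [hlam, Real.sin_nat_mul_pi]

namespace Components

theorem subset_trunc_trunc {K : Components} {m i : ℕ} (hi : i ≤ m) (h : K.A i < K.B i) :
    Icc (K.A i) (K.B i) ⊆ trunc (trunc (K.set m)) := by
  obtain ⟨m₁, e₁, hle₁, hge₁, hlt₁⟩ := exists_trunc_eq K m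
  obtain ⟨m₂, e₂, hle₂, hge₂, hlt₂⟩ := exists_trunc_eq K m₁
  have hi₁ : i ≤ m₁ := by
    by_contra hc
    obtain rfl : i = m := by omega
    exact h.ne (hlt₁ (by omega))
  have hi₂ : i ≤ m₂ := by
    by_contra hc
    obtain rfl : i = m₁ := by omega
    exact h.ne (hlt₂ (by omega))
  rw [e₁, e₂]
  exact fun t ht => mem_set hi₂ ht

/-- A finite sequence of intervals, continued by points. -/
theorem exists_of_fin {m : ℕ} (a b : Fin (m + 1) → ℝ) (hab : ∀ l, a l ≤ b l)
    (hsep : ∀ l k, l < k → b l < a k) : ∃ K : Components,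
    (∀ l : Fin (m + 1), K.A l = a l ∧ K.B l = b l) ∧ ∀ i, m < i → K.A i = K.B i := by
  refine ⟨⟨fun i => if h : i < m + 1 then a ⟨i, h⟩ else b (Fin.last m) + i,
    fun i => if h : i < m + 1 then b ⟨i, h⟩ else b (Fin.last m) + i, fun i => ?_, fun i => ?_⟩,
    fun l => ?_, fun i hi => ?_⟩
  · by_cases h : i < m + 1
    · simp only [dif_pos h, hab]
    · simp only [dif_neg h, le_refl]
  · by_cases h : i < m + 1
    · by_cases h' : i + 1 < m + 1
      · simp only [dif_pos h, dif_pos h']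
        exact hsep _ _ (by simp)
      · simp only [dif_pos h, dif_neg h']
        have : (⟨i, h⟩ : Fin (m + 1)) = Fin.last m := Fin.ext (by simp; omega)
        rw [this]
        have : (0 : ℝ) < ((i + 1 : ℕ) : ℝ) := by positivity
        linarith
    · have h' : ¬ i + 1 < m + 1 := by omega
      simp only [dif_neg h, dif_neg h']
      push_cast
      linarith
  · exact ⟨dif_pos l.2, dif_pos l.2⟩
  · have h : ¬ i < m + 1 := by omega
    simp only [dif_neg h]

end Components

namespace Chain

variable {C : Chain} {m : ℕ}

theorem range_eq_of_sin_iff {ι : Type*} {S : Set ℂ} {Θ : ℝ → ℝ} {lam : ι → ℝ}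
    (hS : ∀ z : ℂ, z ∈ S ↔ ∃ x : ℝ, Real.sin (Θ x) = 0 ∧ (x : ℂ) = z)
    (h : ∀ x, Real.sin (Θ x) = 0 ↔ ∃ i, lam i = x) : Set.range (fun i => (lam i : ℂ)) = S := by
  ext z
  rw [hS]
  constructor
  · rintro ⟨i, rfl⟩
    exact ⟨lam i, (h _).2 ⟨i, rfl⟩, rfl⟩
  · rintro ⟨x, hx, rfl⟩
    obtain ⟨i, rfl⟩ := (h x).1 hx
    exact ⟨i, rfl⟩

/-- The two spectra, indexed by any set of indices that matches the multiples of `π` attained by the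
end angles. -/
theorem exists_interlacing (hm : C.A 0 < C.B 0 ∨ 0 < m) {ι : Type*} [LinearOrder ι] {e : ι → ℕ}
    (he : StrictMono e)
    (hge : ∀ i, ∃ lam, ((e i + 1 : ℕ) : ℝ) * Real.pi ≤ C.endAngle m lam 0)
    (hsurj : ∀ lam, ∀ k : ℕ,
      ((k + 1 : ℕ) : ℝ) * Real.pi ≤ C.endAngle m lam (Real.pi / 2) → ∃ i, e i = k) :
    ∃ lam1 lam0 : ι → ℝ, StrictMono lam1 ∧ StrictMono lam0 ∧
      Set.range (fun n => (lam1 n : ℂ)) = spectrumL1 (C.set m) C.q ∧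
      Set.range (fun n => (lam0 n : ℂ)) = spectrumL0 (C.set m) C.q ∧
      (∀ n, lam1 n < lam0 n) ∧ ∀ n n', e n' = e n + 1 → lam0 n < lam1 n' := by
  have hpi := Real.pi_pos
  have hlt : ∀ lam, C.endAngle m lam 0 < C.endAngle m lam (Real.pi / 2) := fun lam =>
    endAngle_lt le_rfl (by linarith) m
  have hlt' : ∀ lam, C.endAngle m lam (Real.pi / 2) < C.endAngle m lam 0 + Real.pi := fun lam => by
    rw [← endAngle_add_pi]
    exact endAngle_lt le_rfl (by linarith) m
  obtain ⟨c, hc⟩ := exists_endAngle_le_pi_div_two (C := C) m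
  have hmono0 := strictMono_endAngle (C := C) hm le_rfl (by linarith : (0 : ℝ) ≤ Real.pi / 2)
  have hmono1 := strictMono_endAngle (C := C) hm (by linarith : (0 : ℝ) ≤ Real.pi / 2) le_rfl
  obtain ⟨lam0, h0, hs0, hr0⟩ := exists_enumeration he (continuous_endAngle (C := C) 0 m) hmono0
    (endAngle_pos hm) ⟨c, (hlt c).le.trans hc⟩ hge
    (fun x k hk => hsurj x k (hk.symm.le.trans (hlt x).le))
  obtain ⟨lam1, h1, hs1, hr1⟩ := exists_enumeration he (continuous_endAngle (C := C) (Real.pi / 2) m)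
    hmono1 (fun x => (endAngle_pos hm x).trans (hlt x)) ⟨c, hc⟩
    (fun i => (hge i).imp fun x hx => hx.trans (hlt x).le)
    (fun x k hk => hsurj x k hk.symm.le)
  refine ⟨lam1, lam0, hs1, hs0, range_eq_of_sin_iff (mem_spectrumL1_iff hm) hr1,
    range_eq_of_sin_iff (mem_spectrumL0_iff hm) hr0, fun n => hmono1.lt_iff_lt.1 ?_,
    fun n n' hn => hmono1.lt_iff_lt.1 ?_⟩
  -- Both inequalities are compared through Θ(·, π/2): its value at `lam0 n` lies strictly between
  -- Θ(lam0 n, 0) = (e n + 1)π and (e n + 2)π.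
  · change C.endAngle m (lam1 n) (Real.pi / 2) < C.endAngle m (lam0 n) (Real.pi / 2)
    rw [h1, ← h0]
    exact hlt _
  · change C.endAngle m (lam0 n) (Real.pi / 2) < C.endAngle m (lam1 n') (Real.pi / 2)
    rw [h1, hn]
    refine (hlt' _).trans_eq ?_
    rw [h0]
    push_cast
    ring

end Chain

end TimeScale

/-! ### The theorem for the given intervals -/

theorem theorem1 (N M : ℕ) (a b : Fin (N + M) → ℝ)
    (hab : ∀ l, a l ≤ b l)
    (hsep : ∀ l m, l < m → b l < a m)
    (hN : (Finset.univ.filter (fun l => a l < b l)).card = N)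
    (hNM : 0 < N ∨ 3 ≤ M)
    (T : Set ℝ) (hT : T = ⋃ l, Set.Icc (a l) (b l))
    (q : ℝ → ℝ) (hq : ContinuousOn q (TimeScale.trunc (TimeScale.trunc T))) :
    (0 < N → ∃ lam1 lam0 : ℕ → ℝ,
      StrictMono lam1 ∧ StrictMono lam0 ∧
      Set.range (fun n => (lam1 n : ℂ)) = TimeScale.spectrumL1 T q ∧
      Set.range (fun n => (lam0 n : ℂ)) = TimeScale.spectrumL0 T q ∧
      ∀ n, lam1 n < lam0 n ∧ lam0 n < lam1 (n + 1)) ∧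
    (N = 0 → ∃ lam1 lam0 : Fin (M - 2) → ℝ,
      StrictMono lam1 ∧ StrictMono lam0 ∧
      Set.range (fun n => (lam1 n : ℂ)) = TimeScale.spectrumL1 T q ∧
      Set.range (fun n => (lam0 n : ℂ)) = TimeScale.spectrumL0 T q ∧
      ∀ n, lam1 n < lam0 n ∧
        ∀ h : (n : ℕ) + 1 < M - 2, lam0 n < lam1 ⟨(n : ℕ) + 1, h⟩) := by
  obtain ⟨m, hm⟩ : ∃ m, N + M = m + 1 := ⟨N + M - 1, by omega⟩
  have hpi := Real.pi_pos
  generalize hn : N + M = n at a b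
  obtain rfl : n = m + 1 := hn.symm.trans hm
  obtain ⟨K, hK, hK'⟩ := TimeScale.Components.exists_of_fin a b hab hsep
  have hset : T = K.set m := by
    rw [hT]
    ext t
    simp only [Set.mem_iUnion]
    constructor
    · rintro ⟨l, hl⟩
      rw [← (hK l).1, ← (hK l).2] at hl
      exact ⟨l, by omega, hl⟩
    · rintro ⟨i, hi, ht⟩
      refine ⟨⟨i, by omega⟩, ?_⟩
      rw [← (hK _).1, ← (hK _).2]
      exact ht
  rw [hset] at hq ⊢
  have hcont : ∀ i, ContinuousOn q (Set.Icc (K.A i) (K.B i)) := by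
    intro i
    by_cases hlt : K.A i < K.B i
    · refine hq.mono (TimeScale.Components.subset_trunc_trunc ?_ hlt)
      by_contra hi
      exact hlt.ne (hK' i (by omega))
    · exact (Set.subsingleton_Icc_of_ge (not_lt.1 hlt)).continuousOn q
  let C : TimeScale.Chain := ⟨K, q, hcont⟩
  constructor
  · intro hpos
    obtain ⟨l, hl⟩ : ∃ l, a l < b l := by
      rw [← hN, Finset.card_pos] at hpos
      obtain ⟨l, hl⟩ := hpos
      exact ⟨l, (Finset.mem_filter.1 hl).2⟩
    rw [← (hK l).1, ← (hK l).2] at hl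
    have hm0 : C.A 0 < C.B 0 ∨ 0 < m := by
      rcases Nat.eq_zero_or_pos m with rfl | h
      · left
        have : (l : ℕ) = 0 := by omega
        rwa [this] at hl
      · exact Or.inr h
    obtain ⟨lam1, lam0, h1, h0, hr1, hr0, hlt, hlt'⟩ :=
      TimeScale.Chain.exists_interlacing (C := C) (m := m) hm0 (e := fun n : ℕ => n) strictMono_id
        (fun k => TimeScale.Chain.exists_nat_mul_pi_le_endAngle (C := C) (i := l) (by omega) hl _)
        (fun _ k _ => ⟨k, rfl⟩)
    exact ⟨lam1, lam0, h1, h0, hr1, hr0, fun n => ⟨hlt n, hlt' n (n + 1) rfl⟩⟩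
  · intro hzero
    have hM : M = m + 1 := by omega
    have hm0 : 0 < m := by omega
    have hdisc : ∀ i ≤ m, C.A i = C.B i := by
      intro i hi
      rw [hzero, Finset.card_eq_zero, Finset.filter_eq_empty_iff] at hN
      have h := hN (Finset.mem_univ (⟨i, by omega⟩ : Fin (m + 1)))
      rw [← (hK _).1, ← (hK _).2] at h
      exact le_antisymm (K.le i) (not_lt.1 h)
    -- With M = m + 1 points the multiples π, …, (m - 1)π are indexed by `Fin (M - 2)`, and this one
    -- parameter bounds them all.
    obtain ⟨lam, hlam⟩ := TimeScale.Chain.exists_le_endAngle_of_discrete hdisc hm0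
    obtain ⟨lam1, lam0, h1, h0, hr1, hr0, hlt, hlt'⟩ :=
      TimeScale.Chain.exists_interlacing (C := C) (m := m) (Or.inr hm0)
        (e := fun n : Fin (M - 2) => (n : ℕ)) (fun _ _ h => h)
        (fun k => ⟨lam, le_trans (by
          have : (k : ℕ) + 1 ≤ m - 1 := by omega
          gcongr) hlam⟩)
        (fun x k hk => ⟨⟨k, by
          have h := hk.trans_lt (TimeScale.Chain.endAngle_lt_of_discrete hdisc hm0 x)
          have h' : k + 1 < m := by exact_mod_cast lt_of_mul_lt_mul_right h hpi.le
          omega⟩, rfl⟩)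
    exact ⟨lam1, lam0, h1, h0, hr1, hr0, fun n => ⟨hlt n, fun h => hlt' n ⟨n + 1, h⟩ rfl⟩⟩
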